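/- Fix an integer $d\ge 2$. There is a constant $c_2>0$, depending only on $d$, such that the following holds for all integers $n,k\ge 1$, all reals $0\le q_n<p_n\le 1$ and $\varepsilon_n\in[0,1]$, and every surjective map $\Phi^*:[n]\to[k]$ (a partition of $n$ nodes into $k$ nonempty communities). Let $\mathcal E$ be the set of all $d$-element subsets of $[n]$, let $s_a=|(\Phi^*)^{-1}(a)|$ for $a\in[k]$, let $s_{\min}=\min_{a}s_a$, and let $\mathbf X^*\in\{0,1\}^{n\times n}$ be the ground-truth cluster matrix, $\mathbf X^*_{ij}=1$ if and only if $\Phi^*(i)=\Phi^*(j)$. Model ($d$-WHSBM with partial observations). The weights $(W_e)_{e\in\mathcal E}$ are independent random variables with values in $[0,1]$, with $\mathbb E[W_e]=p_n$ if $\Phi^*$ is constant on $e$ and $\mathbb E[W_e]=q_n$ otherwise; their distributions are otherwise arbitrary. Independently of the weights, each $W_e$ is observed with probability $\varepsilon_n$, independently over $e\in\mathcal E$. Let $W'_e=W_e$ if $W_e$ is observed and $W'_e=0$ otherwise, and let $\mathbf A'\in\mathbb R^{n\times n}$ be the similarity matrix, with $\mathbf A'_{ii}=0$ and $\mathbf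 A'_{ij}=\sum_{e\in\mathcal E:\,\{i,j\}\subseteq e}W'_e$ for $i\ne j$. Algorithm. For $\lambda\in\mathbb R$ consider the semidefinite program $$\max_{\mathbf X\in\mathbb R^{n\times n}}\ \langle \mathbf A'-\lambda\mathbf 1_{n\times n},\mathbf X\rangle\quad\text{subject to}\quad \mathbf X\succeq 0,\quad \langle \mathbf I_n,\mathbf X\rangle=n,\quad 0\le \mathbf X_{ij}\le 1\ \text{ for all } i,j\in[n],$$ where $\mathbf 1_{n\times n}$ is the all-one matrix. Let $$p_n^-=\min_{a\in[k]}\left[\binom{s_a-2}{d-2}(p_n-q_n)+\binom{n-2}{d-2}q_n\right],\qquad q_n^+=\binom{n-2}{d-2}q_n$$ be the minimum within-cluster and the maximum cross-cluster similarity, that is, the minimum of the expected similarity $\mathbb E\big[\sum_{e\supseteq\{i,j\}}W_e\big]$ over pairs $i\neq j$ in the same community, and its common value over pairs in different communities. Claim. If $$(p_n-q_n)\sqrt{\frac{\varepsilon_n}{p_n}}\ \ge\ c_2\left(\frac{\sqrt n}{s_{\min}}\right)^{d-2}\max\left\{\frac{\sqrt n}{s_{\min}},\ \sqrt{\frac{\log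 n}{s_{\min}}}\right\},$$ then for every $\lambda$ with $$\tfrac14 p_n^-\varepsilon_n+\tfrac34 q_n^+\varepsilon_n\ \le\ \lambda\ \le\ \tfrac34 p_n^-\varepsilon_n+\tfrac14 q_n^+\varepsilon_n,$$ with probability at least $1-6n^{-11}$ the matrix $\mathbf X^*$ is the unique optimal solution of the semidefinite program. -/

import Mathlib

open MeasureTheory ProbabilityTheory

noncomputable section

namespace WHSBM

/-- The `d`-regular edges on the vertex set `Fin n`: all vertex sets of size `d`. -/
abbrev Edge (n d : ℕ) : Type := {e : Finset (Fin n) // e.card = d}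

/-- An edge is homogeneous for `Φ` if all its vertices lie in one community. -/
def IsHomogeneous {n k d : ℕ} (Φ : Fin n → Fin k) (e : Edge n d) : Prop :=
  ∀ i ∈ e.1, ∀ j ∈ e.1, Φ i = Φ j

/-- The size of the community `a`. -/
def clusterSize {n k : ℕ} (Φ : Fin n → Fin k) (a : Fin k) : ℕ :=
  (Finset.univ.filter fun i => Φ i = a).card

/-- The minimum community size (a minimum, since `k ≥ 1` wherever it is used). -/
def sMin {n k : ℕ} (Φ : Fin n → Fin k) : ℕ := ⨅ a : Fin k, clusterSize Φ a

/-- The `n × k` membership matrix of `Φ`. -/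
def membershipMatrix {n k : ℕ} (Φ : Fin n → Fin k) : Matrix (Fin n) (Fin k) ℝ :=
  Matrix.of fun i a => if Φ i = a then 1 else 0

/-- The cluster matrix `Z Zᵀ` of `Φ`. -/
def clusterMatrix {n k : ℕ} (Φ : Fin n → Fin k) : Matrix (Fin n) (Fin n) ℝ :=
  membershipMatrix Φ * (membershipMatrix Φ).transpose

open scoped Classical in
/-- The random weights `W` (on the probability space `(Ω, μ)`) are drawn from the weighted
`d`-uniform hypergraph stochastic block model with ground truth `Φ`: independent, with values
in `[0, 1]`, of mean `p` on homogeneous and `q` on heterogeneous edges.  Nothing else about the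
distributions is prescribed; they may differ from edge to edge. -/
structure IsSample {n k d : ℕ} (p q : ℝ) (Φ : Fin n → Fin k) {Ω : Type*} [MeasurableSpace Ω]
    (μ : Measure Ω) (W : Edge n d → Ω → ℝ) : Prop where
  measurable : ∀ e, Measurable (W e)
  mem_Icc : ∀ e, ∀ᵐ ω ∂μ, W e ω ∈ Set.Icc (0 : ℝ) 1
  indep : iIndepFun W μ
  mean : ∀ e, ∫ ω, W e ω ∂μ = if IsHomogeneous Φ e then p else q

/-- `B e` says whether the weight of the edge `e` is observed: the `B e` are independent
Bernoulli(`ε`) variables, and the family `B` is independent of the family `W`. -/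
structure IsObservation {n d : ℕ} (ε : ℝ) {Ω : Type*} [MeasurableSpace Ω]
    (μ : Measure Ω) (W : Edge n d → Ω → ℝ) (B : Edge n d → Ω → Bool) : Prop where
  measurable : ∀ e, Measurable (B e)
  indep : iIndepFun B μ
  prob : ∀ e, μ.real {ω | B e ω = true} = ε
  indep_weights : IndepFun (fun ω e => W e ω) (fun ω e => B e ω) μ

/-- The observed weights; `none` marks an unobserved entry. -/
def observed {n d : ℕ} (w : Edge n d → ℝ) (b : Edge n d → Bool) : Edge n d → Option ℝ :=
  fun e => if b e then some (w e) else none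

/-- Zero imputation: every unobserved weight is set to zero. -/
def zeroImpute {n d : ℕ} (w : Edge n d → Option ℝ) : Edge n d → ℝ :=
  fun e => (w e).getD 0

/-- The similarity matrix of a weighted `d`-uniform hypergraph. -/
def similarityMatrix {n d : ℕ} (w : Edge n d → ℝ) : Matrix (Fin n) (Fin n) ℝ :=
  Matrix.of fun i j =>
    if i = j then 0 else ∑ e : Edge n d, if i ∈ e.1 ∧ j ∈ e.1 then w e else 0

/-- The expected similarity of two distinct nodes in the communities `a` and `b`
(see `integral_similarityMatrix`). -/
def expectedSimilarity {n k : ℕ} (d : ℕ) (p q : ℝ) (Φ : Fin n → Fin k) (a b : Fin k) : ℝ :=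
  if a = b then
    ((clusterSize Φ a - 2).choose (d - 2) : ℝ) * (p - q) + ((n - 2).choose (d - 2) : ℝ) * q
  else ((n - 2).choose (d - 2) : ℝ) * q

/-- The minimum within-cluster similarity. -/
def pMinus {n k : ℕ} (d : ℕ) (p q : ℝ) (Φ : Fin n → Fin k) : ℝ :=
  ⨅ a : Fin k, expectedSimilarity d p q Φ a a

/-- The maximum cross-cluster similarity: the common value of all `expectedSimilarity d p q Φ a b`
with `a ≠ b`, and this same number if there is only one community. -/
def qPlus (n d : ℕ) (q : ℝ) : ℝ := ((n - 2).choose (d - 2) : ℝ) * q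

/-- The trace inner product of square matrices. -/
def frob {n : ℕ} (M N : Matrix (Fin n) (Fin n) ℝ) : ℝ := ∑ i, ∑ j, M i j * N i j

/-- The feasible region of the semidefinite program. -/
def sdpFeasible (n : ℕ) : Set (Matrix (Fin n) (Fin n) ℝ) :=
  {X | X.PosSemidef ∧ frob 1 X = n ∧ ∀ i j, 0 ≤ X i j ∧ X i j ≤ 1}

/-- The optimal solutions of the semidefinite program: maximize `⟨A - l 𝟏, X⟩`, where `𝟏` is the
all-one matrix, over the feasible region. -/
def sdpSolutions {n : ℕ} (A : Matrix (Fin n) (Fin n) ℝ) (l : ℝ) :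
    Set (Matrix (Fin n) (Fin n) ℝ) :=
  {X | X ∈ sdpFeasible n ∧
    ∀ Y ∈ sdpFeasible n, frob (A - Matrix.of fun _ _ => l) Y ≤ frob (A - Matrix.of fun _ _ => l) X}

/-- Number of edges through two distinct vertices inside a vertex set. -/
theorem card_edges_through {n d : ℕ} (hd : 2 ≤ d) (S : Finset (Fin n)) {i j : Fin n}
    (hij : i ≠ j) (hi : i ∈ S) (hj : j ∈ S) :
    (Finset.univ.filter fun e : Edge n d => (i ∈ e.1 ∧ j ∈ e.1) ∧ e.1 ⊆ S).card
      = (S.card - 2).choose (d - 2) := by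
  have hc : ((S.erase i).erase j).card = S.card - 2 := by
    rw [Finset.card_erase_of_mem (by simp [hij.symm, hj]), Finset.card_erase_of_mem hi]
    omega
  rw [← hc, ← Finset.card_powersetCard]
  refine Finset.card_bij' (fun e _ => (e.1.erase i).erase j)
    (fun t ht => ⟨insert i (insert j t), ?_⟩) ?_ ?_ ?_ ?_
  · rw [Finset.mem_powersetCard] at ht
    have h1 : j ∉ t := fun h => by simpa using ht.1 h
    have h2 : i ∉ insert j t := fun h => by
      rcases Finset.mem_insert.1 h with h | h
      · exact hij h
      · simpa using ht.1 h
    rw [Finset.card_insert_of_notMem h2, Finset.card_insert_of_notMem h1, ht.2]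
    omega
  · rintro ⟨e, he⟩ h
    simp only [Finset.mem_filter, Finset.mem_univ, true_and] at h
    rw [Finset.mem_powersetCard]
    refine ⟨Finset.erase_subset_erase _ (Finset.erase_subset_erase _ h.2), ?_⟩
    rw [Finset.card_erase_of_mem (by simp [hij.symm, h.1.2]), Finset.card_erase_of_mem h.1.1]
    omega
  · intro t ht
    rw [Finset.mem_powersetCard] at ht
    simp only [Finset.mem_filter, Finset.mem_univ, true_and]
    refine ⟨by simp, ?_⟩
    intro x hx
    simp only [Finset.mem_insert] at hx
    rcases hx with rfl | rfl | hx
    · exact hi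
    · exact hj
    · exact Finset.mem_of_mem_erase (Finset.mem_of_mem_erase (ht.1 hx))
  · rintro ⟨e, he⟩ h
    simp only [Finset.mem_filter, Finset.mem_univ, true_and] at h
    apply Subtype.ext
    simp only
    rw [Finset.insert_erase (by simp [hij.symm, h.1.2]), Finset.insert_erase h.1.1]
  · intro t ht
    rw [Finset.mem_powersetCard] at ht
    ext x
    simp only [Finset.mem_erase, Finset.mem_insert]
    constructor
    · rintro ⟨h1, h2, h | h | h⟩
      · exact absurd h h2
      · exact absurd h h1
      · exact h
    · intro h
      have := ht.1 h
      simp only [Finset.mem_erase] at this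
      exact ⟨this.1, this.2.1, Or.inr (Or.inr h)⟩

/-- `expectedSimilarity` is the expectation of the off-diagonal entries of the similarity
matrix of a sample. -/
theorem integral_similarityMatrix {n k d : ℕ} (hd : 2 ≤ d) {p q : ℝ} {Φ : Fin n → Fin k}
    {Ω : Type*} [MeasurableSpace Ω] {μ : Measure Ω} [IsProbabilityMeasure μ]
    {W : Edge n d → Ω → ℝ} (hW : IsSample p q Φ μ W) {i j : Fin n} (hij : i ≠ j) :
    ∫ ω, similarityMatrix (fun e => W e ω) i j ∂μ = expectedSimilarity d p q Φ (Φ i) (Φ j) := by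
  classical
  have hint : ∀ e, Integrable (W e) μ := fun e =>
    Integrable.of_mem_Icc 0 1 (hW.measurable e).aemeasurable (hW.mem_Icc e)
  simp only [similarityMatrix, Matrix.of_apply, if_neg hij]
  rw [integral_finsetSum]
  swap
  · intro e _
    by_cases h : i ∈ e.1 ∧ j ∈ e.1
    · simpa [h] using hint e
    · simp [h]
  have h1 : ∀ e : Edge n d, ∫ ω, (if i ∈ e.1 ∧ j ∈ e.1 then W e ω else 0) ∂μ =
      (if i ∈ e.1 ∧ j ∈ e.1 then q else 0) +
        (if (i ∈ e.1 ∧ j ∈ e.1) ∧ IsHomogeneous Φ e then p - q else 0) := by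
    intro e
    by_cases h : i ∈ e.1 ∧ j ∈ e.1
    · simp only [h, and_self, if_true, true_and, hW.mean e]
      split_ifs <;> ring
    · simp [h]
  simp only [h1]
  rw [Finset.sum_add_distrib, ← Finset.sum_filter, ← Finset.sum_filter, Finset.sum_const,
    Finset.sum_const, nsmul_eq_mul, nsmul_eq_mul]
  have hq := card_edges_through (d := d) hd Finset.univ hij (Finset.mem_univ i) (Finset.mem_univ j)
  simp only [Finset.subset_univ, and_true, Finset.card_univ, Fintype.card_fin] at hq
  rw [hq, expectedSimilarity]
  by_cases hΦ : Φ i = Φ j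
  · rw [if_pos hΦ]
    have hp := card_edges_through (d := d) hd (Finset.univ.filter fun x => Φ x = Φ i) hij
      (by simp) (by simp [hΦ])
    have h2 : (Finset.univ.filter fun e : Edge n d =>
        (i ∈ e.1 ∧ j ∈ e.1) ∧ IsHomogeneous Φ e) = Finset.univ.filter fun e : Edge n d =>
        (i ∈ e.1 ∧ j ∈ e.1) ∧ e.1 ⊆ Finset.univ.filter fun x => Φ x = Φ i := by
      ext e
      simp only [Finset.mem_filter, Finset.mem_univ, true_and, and_congr_right_iff]
      intro h
      constructor
      · intro hh x hx
        simpa using hh x hx i h.1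
      · intro hh x hx y hy
        have hx' := hh hx
        have hy' := hh hy
        simp only [Finset.mem_filter, Finset.mem_univ, true_and] at hx' hy'
        rw [hx', hy']
    rw [h2, hp, clusterSize]
    ring
  · rw [if_neg hΦ]
    have h2 : (Finset.univ.filter fun e : Edge n d =>
        (i ∈ e.1 ∧ j ∈ e.1) ∧ IsHomogeneous Φ e) = ∅ := by
      ext e
      simp only [Finset.mem_filter, Finset.mem_univ, true_and, Finset.notMem_empty, iff_false]
      rintro ⟨h, hh⟩
      exact hΦ (hh i h.1 j h.2)
    rw [h2]
    simp

end WHSBM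

end

noncomputable section

namespace WHSBM

/-! The zero-imputed weights are again independent with values in `[0, 1]`, of mean `εp` on
homogeneous and `εq` on heterogeneous edges. So the similarity matrix is `P + M`, with `P` its mean
and `M` centred noise. For feasible `Y` put `Δ = Y - X*`, with entrywise norm `‖Δ‖₁`. The trace
constraint and the entrywise bound force `Y` to have unit diagonal, and the choice of `λ` gives `⟨P
- λ𝟏, X* - Y⟩ ≥ (γ/4) ‖Δ‖₁`, where `γ` is a lower bound for the expected similarity gap. It remains
to show that `⟨M, Δ⟩` is at most a smaller multiple of `‖Δ‖₁`.

Let `Π` be the projection onto vectors constant on communities. Then `Δ = ΠΔ + ΔΠ - ΠΔΠ +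
(1-Π)Δ(1-Π)`. The first three terms pair with `M` to at most `3η ‖Δ‖₁`, where `η` bounds the entries
of `ΠM`. Since `(1-Π)X* = 0`, the last term is `(1-Π)Y(1-Π)`, which is positive semidefinite of
trace at most `‖Δ‖₁ / s_min`; it pairs to at most `(K / s_min) ‖Δ‖₁` if `K` bounds the quadratic
form of `M` (`frob_sub_clusterMatrix_le`, `sdpSolutions_eq_singleton`).

The number `η` comes from Bernstein's inequality and a union bound (`measure_averaging_gt_le`). The
number `K` comes from the method of Kahn and Szemerédi (`measure_quadratic_form_gt_le`): the
supremum over unit vectors is reduced to a net of integer vectors; pairs of coordinates with small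
product are handled by Bernstein, the others by a discrepancy property and bounded row sums. Entries
of `M` are dependent, but each linear functional of `M` is a combination of independent edge
weights, which costs only powers of `d`.

With `θ = pε n^(d-2)`, a bound for all mean entries, and `r = √(nθ)`, one gets `K` of order `r`.
What is needed is thus `r ≲ γ s_min` and `θ log n ≲ γ² s_min`, the two members of the maximum in the
hypothesis. The same hypothesis also forces `log n ≤ r²` and `s_min` large compared with `d`, so no
further sparsity assumption enters. -/

/-! ### Bounded families and zero imputation. -/

/-- Independent random weights with values in `[0, 1]` whose means are at most `ρ`. -/
structure IsBoundedFamily {E Ω : Type*} [MeasurableSpace Ω] (ρ : ℝ) (μ : Measure Ω)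
    (w : E → Ω → ℝ) : Prop where
  measurable : ∀ e, Measurable (w e)
  mem_Icc : ∀ e, ∀ᵐ ω ∂μ, w e ω ∈ Set.Icc (0 : ℝ) 1
  indep : iIndepFun w μ
  mean_le : ∀ e, ∫ ω, w e ω ∂μ ≤ ρ

/-- Measurable rectangles form a π-system generating the product σ-algebra, and on their preimages
the probability factors first between `X` and `Y`, then over the indices. -/
theorem iIndepFun_prodMk_of_indepFun {ι Ω α β : Type*} [Fintype ι] [MeasurableSpace Ω]
    [MeasurableSpace α] [MeasurableSpace β] {μ : Measure Ω} [IsProbabilityMeasure μ]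
    {X : ι → Ω → α} {Y : ι → Ω → β} (hX : ∀ i, Measurable (X i)) (hY : ∀ i, Measurable (Y i))
    (hXi : iIndepFun X μ) (hYi : iIndepFun Y μ)
    (hXY : IndepFun (fun ω i => X i ω) (fun ω i => Y i ω) μ) :
    iIndepFun (fun i ω => (X i ω, Y i ω)) μ := by
  rw [iIndepFun_iff_iIndep]
  refine iIndepSets.iIndep (fun i => ((hX i).prodMk (hY i)).comap_le)
    (fun i => Set.preimage (fun ω => (X i ω, Y i ω)) ''
      (Set.image2 (· ×ˢ ·) {s | MeasurableSet s} {t | MeasurableSet t})) ?_ ?_ ?_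
  · intro i
    exact (isPiSystem_prod (α := α) (β := β)).comap (fun ω => (X i ω, Y i ω))
  · intro i
    rw [← MeasurableSpace.comap_generateFrom, generateFrom_prod]
  · rw [iIndepSets_iff]
    intro S f hf
    have hf' : ∀ i, ∃ s : Set α, ∃ t : Set β, MeasurableSet s ∧ MeasurableSet t ∧
        (i ∈ S → f i = X i ⁻¹' s ∩ Y i ⁻¹' t) := by
      intro i
      by_cases hi : i ∈ S
      · obtain ⟨u, ⟨s, hs, t, ht, rfl⟩, h⟩ := hf i hi
        refine ⟨s, t, hs, ht, fun _ => ?_⟩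
        rw [← h]
        rfl
      · exact ⟨∅, ∅, .empty, .empty, fun h => absurd h hi⟩
    choose s t hs ht hst using hf'
    have h1 : (⋂ i ∈ S, f i) = (fun ω i => X i ω) ⁻¹' (⋂ i ∈ S, (fun x => x i) ⁻¹' s i) ∩
        (fun ω i => Y i ω) ⁻¹' (⋂ i ∈ S, (fun x => x i) ⁻¹' t i) := by
      ext ω
      simp only [Set.mem_iInter, Set.mem_inter_iff, Set.mem_preimage]
      constructor
      · intro h
        exact ⟨fun i hi => by have := h i hi; rw [hst i hi] at this; exact this.1,
          fun i hi => by have := h i hi; rw [hst i hi] at this; exact this.2⟩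
      · intro h i hi
        rw [hst i hi]
        exact ⟨h.1 i hi, h.2 i hi⟩
    have ms : MeasurableSet (⋂ i ∈ S, (fun x : ι → α => x i) ⁻¹' s i) :=
      Finset.measurableSet_biInter _ fun i _ => measurable_pi_apply i (hs i)
    have mt : MeasurableSet (⋂ i ∈ S, (fun x : ι → β => x i) ⁻¹' t i) :=
      Finset.measurableSet_biInter _ fun i _ => measurable_pi_apply i (ht i)
    rw [h1, hXY.measure_inter_preimage_eq_mul _ _ ms mt]
    have h2 : (fun ω i => X i ω) ⁻¹' (⋂ i ∈ S, (fun x : ι → α => x i) ⁻¹' s i)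
        = ⋂ i ∈ S, X i ⁻¹' s i := by
      ext; simp
    have h3 : (fun ω i => Y i ω) ⁻¹' (⋂ i ∈ S, (fun x : ι → β => x i) ⁻¹' t i)
        = ⋂ i ∈ S, Y i ⁻¹' t i := by
      ext; simp
    rw [h2, h3, hXi.measure_inter_preimage_eq_mul S (fun i _ => hs i),
      hYi.measure_inter_preimage_eq_mul S (fun i _ => ht i), ← Finset.prod_mul_distrib]
    refine Finset.prod_congr rfl fun i hi => ?_
    rw [hst i hi]
    have h4 : IndepFun (X i) (Y i) μ :=
      hXY.comp (measurable_pi_apply i) (measurable_pi_apply i)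
    exact (h4.measure_inter_preimage_eq_mul _ _ (hs i) (ht i)).symm

theorem zeroImpute_observed {n d : ℕ} (w : Edge n d → ℝ) (b : Edge n d → Bool) (e : Edge n d) :
    zeroImpute (observed w b) e = if b e then w e else 0 := by
  unfold zeroImpute observed
  split_ifs <;> simp

open scoped Classical in
theorem IsObservation.integral_zeroImpute {n k d : ℕ} {p q ε : ℝ} {Φ : Fin n → Fin k}
    {Ω : Type*} [MeasurableSpace Ω] {μ : Measure Ω} [IsProbabilityMeasure μ]
    {W : Edge n d → Ω → ℝ} {B : Edge n d → Ω → Bool} (hW : IsSample p q Φ μ W)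
    (hB : IsObservation ε μ W B) (e : Edge n d) :
    ∫ ω, zeroImpute (observed (fun e => W e ω) (fun e => B e ω)) e ∂μ
      = ε * if IsHomogeneous Φ e then p else q := by
  simp only [zeroImpute_observed]
  have h4 : IndepFun (W e) (B e) μ :=
    hB.indep_weights.comp (measurable_pi_apply e) (measurable_pi_apply e)
  have h5 : IndepFun (W e) (fun ω => if B e ω = true then (1 : ℝ) else 0) μ :=
    h4.comp (φ := id) (ψ := fun b : Bool => if b = true then (1 : ℝ) else 0) measurable_id
      (measurable_of_countable _)
  have hm : MeasurableSet {ω | B e ω = true} := hB.measurable e (measurableSet_singleton true)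
  have h6 : (fun ω => if B e ω = true then (1 : ℝ) else 0)
      = Set.indicator {ω | B e ω = true} (fun _ => (1 : ℝ)) := by
    ext ω
    simp [Set.indicator]
  have h7 := h5.integral_mul_eq_mul_integral (hW.measurable e).aestronglyMeasurable
    (by rw [h6]; exact (measurable_const.indicator hm).aestronglyMeasurable)
  have h8 : (fun ω => if B e ω = true then W e ω else 0)
      = W e * fun ω => if B e ω = true then (1 : ℝ) else 0 := by
    ext ω
    simp
  rw [h8, h7, hW.mean e, h6, integral_indicator_const _ hm, hB.prob e]
  simp [mul_comm]

/-- An imputed weight is a function of the pair `(W e, B e)`, and these pairs are independent. The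
noise estimates use nothing about the model beyond this structure. -/
theorem IsObservation.isBoundedFamily {n k d : ℕ} {p q ε : ℝ} {Φ : Fin n → Fin k}
    (hqp : q ≤ p) (hε : 0 ≤ ε)
    {Ω : Type*} [MeasurableSpace Ω] {μ : Measure Ω} [IsProbabilityMeasure μ]
    {W : Edge n d → Ω → ℝ} {B : Edge n d → Ω → Bool} (hW : IsSample p q Φ μ W)
    (hB : IsObservation ε μ W B) :
    IsBoundedFamily (p * ε) μ
      (fun e ω => zeroImpute (observed (fun e => W e ω) (fun e => B e ω)) e) := by
  refine ⟨fun e => ?_, fun e => ?_, ?_, fun e => ?_⟩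
  · simp only [zeroImpute_observed]
    exact Measurable.ite (hB.measurable e (measurableSet_singleton true)) (hW.measurable e)
      measurable_const
  · filter_upwards [hW.mem_Icc e] with ω h
    simp only [zeroImpute_observed]
    split_ifs
    · exact h
    · simp
  · have h := iIndepFun_prodMk_of_indepFun hW.measurable hB.measurable hW.indep hB.indep
      hB.indep_weights
    have hg : Measurable (fun x : ℝ × Bool => if x.2 = true then x.1 else 0) :=
      Measurable.ite (measurable_snd (measurableSet_singleton true)) measurable_fst
        measurable_const
    have := h.comp (fun _ x => if x.2 = true then x.1 else 0) (fun _ => hg)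
    simp only [zeroImpute_observed]
    exact this
  · rw [hB.integral_zeroImpute hW e, mul_comm p]
    refine mul_le_mul_of_nonneg_left ?_ hε
    split_ifs <;> linarith

/-! ### Moment generating functions and tail bounds. -/

section Tails

variable {E Ω : Type*} [MeasurableSpace Ω] {ρ : ℝ} {μ : Measure Ω} [IsProbabilityMeasure μ]
  {w : E → Ω → ℝ}

theorem IsBoundedFamily.integrable (h : IsBoundedFamily ρ μ w) (e : E) : Integrable (w e) μ :=
  Integrable.of_mem_Icc 0 1 (h.measurable e).aemeasurable (h.mem_Icc e)

theorem IsBoundedFamily.mean_mem_Icc (h : IsBoundedFamily ρ μ w) (e : E) :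
    ∫ ω, w e ω ∂μ ∈ Set.Icc (0 : ℝ) 1 := by
  constructor
  · exact integral_nonneg_of_ae ((h.mem_Icc e).mono fun ω hω => hω.1)
  · have := integral_mono_ae (h.integrable e) (integrable_const (1 : ℝ))
      ((h.mem_Icc e).mono fun ω hω => hω.2)
    simpa using this

theorem exp_mul_le_one_add_mul {x t : ℝ} (h0 : 0 ≤ x) (h1 : x ≤ 1) :
    Real.exp (x * t) ≤ 1 + x * (Real.exp t - 1) := by
  have := convexOn_exp.2 (Set.mem_univ (0 : ℝ)) (Set.mem_univ t) (sub_nonneg.2 h1) h0 (by ring)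
  simp only [smul_eq_mul, mul_zero, zero_add, Real.exp_zero, mul_one] at this
  linarith

theorem IsBoundedFamily.integrable_exp (h : IsBoundedFamily ρ μ w) (e : E) (c L m : ℝ) :
    Integrable (fun ω => Real.exp (L * (c * (w e ω - m)))) μ := by
  have hmeas : Measurable (fun ω => Real.exp (L * (c * (w e ω - m)))) := by
    have := h.measurable e
    fun_prop
  refine Integrable.of_mem_Icc 0 (Real.exp (|L * c| * (1 + |m|))) hmeas.aemeasurable ?_
  filter_upwards [h.mem_Icc e] with ω hω
  refine ⟨(Real.exp_pos _).le, Real.exp_le_exp.2 ?_⟩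
  rw [← mul_assoc]
  refine (le_abs_self _).trans ?_
  rw [abs_mul]
  refine mul_le_mul_of_nonneg_left ?_ (abs_nonneg _)
  refine (abs_sub _ _).trans ?_
  rw [abs_of_nonneg hω.1]
  linarith [hω.2]

/-- The exponential lies below its chord over `[0, L K]`. No smallness of `L` is required, because
the discrepancy estimate uses exponents `L K` that grow with the levels. -/
theorem IsBoundedFamily.mgf_mul_le (h : IsBoundedFamily ρ μ w) (e : E) {c K L : ℝ}
    (hc : 0 ≤ c) (hcK : c ≤ K) (hK : 0 < K) (hL : 0 ≤ L) :
    mgf (fun ω => c * w e ω) μ L ≤ Real.exp (c * (ρ * ((Real.exp (L * K) - 1) / K))) := by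
  have hexp : 0 ≤ (Real.exp (L * K) - 1) / K :=
    div_nonneg (sub_nonneg.2 (Real.one_le_exp (by positivity))) hK.le
  have hb : ∀ᵐ ω ∂μ, Real.exp (L * (c * w e ω))
      ≤ 1 + (c * ((Real.exp (L * K) - 1) / K)) * w e ω := by
    filter_upwards [h.mem_Icc e] with ω hω
    have h1 := exp_mul_le_one_add_mul (x := c * w e ω / K) (t := L * K)
      (div_nonneg (mul_nonneg hc hω.1) hK.le)
      ((div_le_one hK).2 (by nlinarith [hω.1, hω.2]))
    have h2 : c * w e ω / K * (L * K) = L * (c * w e ω) := by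
      field_simp
    rw [h2] at h1
    refine h1.trans_eq ?_
    ring
  have hi := h.integrable_exp e c L 0
  simp only [sub_zero] at hi
  have h2 := integral_mono_ae hi
    ((integrable_const (1 : ℝ)).add ((h.integrable e).const_mul _)) hb
  simp only [Pi.add_apply] at h2
  rw [integral_add (integrable_const _) ((h.integrable e).const_mul _),
    integral_const_mul] at h2
  simp only [integral_const, probReal_univ, smul_eq_mul, mul_one] at h2
  unfold mgf
  refine h2.trans ?_
  have h3 : c * ((Real.exp (L * K) - 1) / K) * ∫ ω, w e ω ∂μ
      ≤ c * (ρ * ((Real.exp (L * K) - 1) / K)) := by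
    have := mul_le_mul_of_nonneg_left (h.mean_le e) (mul_nonneg hc hexp)
    linarith
  linarith [Real.add_one_le_exp (c * (ρ * ((Real.exp (L * K) - 1) / K)))]

/-- As `w² ≤ w` on `[0, 1]`, the variance is at most the mean; this keeps sparse weights at the
scale `ρ`. -/
theorem IsBoundedFamily.integral_sq_le (h : IsBoundedFamily ρ μ w) (e : E) :
    Integrable (fun ω => (w e ω - ∫ ω, w e ω ∂μ) ^ 2) μ ∧
    ∫ ω, (w e ω - ∫ ω, w e ω ∂μ) ^ 2 ∂μ ≤ ρ := by
  set m := ∫ ω, w e ω ∂μ with hm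
  have hmI : m ∈ Set.Icc (0 : ℝ) 1 := h.mean_mem_Icc e
  have hmeas : Measurable (fun ω => (w e ω - m) ^ 2) := by
    have := h.measurable e
    fun_prop
  have hi : Integrable (fun ω => (w e ω - m) ^ 2) μ := by
    refine Integrable.of_mem_Icc 0 1 hmeas.aemeasurable ?_
    filter_upwards [h.mem_Icc e] with ω hω
    refine ⟨sq_nonneg _, ?_⟩
    rw [sq_le_one_iff_abs_le_one, abs_le]
    constructor <;> linarith [hω.1, hω.2, hmI.1, hmI.2]
  refine ⟨hi, ?_⟩
  have hb : ∀ᵐ ω ∂μ, (w e ω - m) ^ 2 ≤ m ^ 2 + (1 - 2 * m) * w e ω := by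
    filter_upwards [h.mem_Icc e] with ω hω
    nlinarith [hω.1, hω.2]
  have h2 := integral_mono_ae hi
    ((integrable_const (m ^ 2)).add ((h.integrable e).const_mul _)) hb
  simp only [Pi.add_apply] at h2
  rw [integral_add (integrable_const _) ((h.integrable e).const_mul _),
    integral_const_mul, ← hm] at h2
  simp only [integral_const, probReal_univ, smul_eq_mul, one_mul] at h2
  have := h.mean_le e
  nlinarith [hmI.1]

/-- Integrate `exp x ≤ 1 + x + x²`, valid for `|x| ≤ 1`; the linear term has mean zero. -/
theorem IsBoundedFamily.mgf_centered_le (h : IsBoundedFamily ρ μ w) (e : E) {c L : ℝ}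
    (hcL : |L * c| ≤ 1) :
    mgf (fun ω => c * (w e ω - ∫ ω, w e ω ∂μ)) μ L ≤ Real.exp (ρ * (L * c) ^ 2) := by
  set m := ∫ ω, w e ω ∂μ with hm
  have hmI : m ∈ Set.Icc (0 : ℝ) 1 := h.mean_mem_Icc e
  obtain ⟨hi2, hle⟩ := h.integral_sq_le e
  rw [← hm] at hi2 hle
  have hb : ∀ᵐ ω ∂μ, Real.exp (L * (c * (w e ω - m)))
      ≤ 1 + (L * c) * (w e ω - m) + (L * c) ^ 2 * (w e ω - m) ^ 2 := by
    filter_upwards [h.mem_Icc e] with ω hω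
    have h1 : |L * c * (w e ω - m)| ≤ 1 := by
      rw [abs_mul]
      refine mul_le_one₀ hcL (abs_nonneg _) ?_
      rw [abs_le]
      constructor <;> linarith [hω.1, hω.2, hmI.1, hmI.2]
    have h2 := (abs_le.1 (Real.abs_exp_sub_one_sub_id_le h1)).2
    rw [mul_pow] at h2
    rw [← mul_assoc]
    linarith
  have hi1 : Integrable (fun ω => L * c * (w e ω - m)) μ :=
    ((h.integrable e).sub (integrable_const m)).const_mul _
  have hi3 : Integrable (fun ω => 1 + L * c * (w e ω - m)) μ := (integrable_const (1 : ℝ)).add hi1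
  have h2 := integral_mono_ae (h.integrable_exp e c L m) (hi3.add (hi2.const_mul _)) hb
  simp only [Pi.add_apply] at h2
  rw [integral_add hi3 (hi2.const_mul _), integral_add (integrable_const _) hi1, integral_const_mul, integral_const_mul,
    integral_sub (h.integrable e) (integrable_const _)] at h2
  simp only [integral_const, probReal_univ, smul_eq_mul, one_mul, ← hm, sub_self, mul_zero,
    add_zero] at h2
  unfold mgf
  refine h2.trans ?_
  have h3 := mul_le_mul_of_nonneg_left hle (sq_nonneg (L * c))
  linarith [Real.add_one_le_exp (ρ * (L * c) ^ 2)]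

variable [Fintype E]

/-- Chernoff's bound for nonnegative combinations of a bounded family. -/
theorem IsBoundedFamily.measure_sum_ge_le (h : IsBoundedFamily ρ μ w) {c : E → ℝ} {K L : ℝ}
    (hc : ∀ e, 0 ≤ c e) (hcK : ∀ e, c e ≤ K) (hK : 0 < K) (hL : 0 ≤ L) (t : ℝ) :
    μ.real {ω | t ≤ ∑ e, c e * w e ω}
      ≤ Real.exp (-L * t + (∑ e, c e) * (ρ * ((Real.exp (L * K) - 1) / K))) := by
  have hind : iIndepFun (fun e ω => c e * w e ω) μ :=
    h.indep.comp (fun e x => c e * x) (fun e => by fun_prop)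
  have hmeas : ∀ e, Measurable (fun ω => c e * w e ω) := fun e => (h.measurable e).const_mul _
  have hint : ∀ e, Integrable (fun ω => Real.exp (L * (c e * w e ω))) μ := fun e => by
    simpa using h.integrable_exp e (c e) L 0
  have h1 := measure_ge_le_exp_mul_mgf (μ := μ) (X := ∑ e, fun ω => c e * w e ω) t hL
    (hind.integrable_exp_mul_sum hmeas fun e _ => hint e)
  rw [hind.mgf_sum hmeas] at h1
  simp only [Finset.sum_apply] at h1
  refine h1.trans ?_
  rw [Real.exp_add, Finset.sum_mul, Real.exp_sum]
  exact mul_le_mul_of_nonneg_left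
    (Finset.prod_le_prod (fun e _ => mgf_nonneg)
      fun e _ => h.mgf_mul_le e (hc e) (hcK e) hK hL) (Real.exp_pos _).le

/-- Bernstein's bound for centered combinations of a bounded family. -/
theorem IsBoundedFamily.measure_sum_centered_ge_le (h : IsBoundedFamily ρ μ w) {c : E → ℝ}
    {K L : ℝ} (hcK : ∀ e, |c e| ≤ K) (hL : 0 ≤ L) (hLK : L * K ≤ 1) (t : ℝ) :
    μ.real {ω | t ≤ ∑ e, c e * (w e ω - ∫ ω, w e ω ∂μ)}
      ≤ Real.exp (-L * t + ρ * L ^ 2 * ∑ e, c e ^ 2) := by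
  set m : E → ℝ := fun e => ∫ ω, w e ω ∂μ with hm
  have hind : iIndepFun (fun e ω => c e * (w e ω - m e)) μ :=
    h.indep.comp (fun e x => c e * (x - m e)) (fun e => by fun_prop)
  have hmeas : ∀ e, Measurable (fun ω => c e * (w e ω - m e)) := fun e => by
    have := h.measurable e
    fun_prop
  have h1 := measure_ge_le_exp_mul_mgf (μ := μ) (X := ∑ e, fun ω => c e * (w e ω - m e)) t hL
    (hind.integrable_exp_mul_sum hmeas fun e _ => h.integrable_exp e (c e) L (m e))
  rw [hind.mgf_sum hmeas] at h1
  simp only [Finset.sum_apply] at h1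
  refine h1.trans ?_
  rw [Real.exp_add, Finset.mul_sum, Real.exp_sum]
  refine mul_le_mul_of_nonneg_left
    (Finset.prod_le_prod (fun e _ => mgf_nonneg) fun e _ => ?_) (Real.exp_pos _).le
  refine (h.mgf_centered_le e ?_).trans_eq ?_
  · rw [abs_mul, abs_of_nonneg hL]
    exact (mul_le_mul_of_nonneg_left (hcK e) hL).trans hLK
  · rw [mul_pow, mul_assoc]

end Tails

/-! ### Linear functionals of the similarity matrix. -/

/-- The sum of the entries of `f` over the ordered pairs of distinct vertices of an edge. -/
def pairSum {n d : ℕ} (f : Matrix (Fin n) (Fin n) ℝ) (e : Edge n d) : ℝ :=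
  ∑ x ∈ e.1.offDiag, f x.1 x.2

section PairSum

variable {n d : ℕ}

theorem pairSum_eq_sum_ite (f : Matrix (Fin n) (Fin n) ℝ) (e : Edge n d) :
    pairSum f e = ∑ i, ∑ j, if i ≠ j ∧ i ∈ e.1 ∧ j ∈ e.1 then f i j else 0 := by
  rw [pairSum, ← Finset.sum_product', ← Finset.sum_filter]
  refine Finset.sum_congr ?_ fun _ _ => rfl
  ext x
  simp only [Finset.mem_offDiag, Finset.univ_product_univ, Finset.mem_filter, Finset.mem_univ,
    true_and]
  tauto

theorem card_offDiag_le (e : Edge n d) : (e.1.offDiag.card : ℝ) ≤ (d : ℝ) ^ 2 := by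
  rw [Finset.offDiag_card, e.2, sq]
  exact_mod_cast Nat.sub_le _ _

/-- One edge feeds all its pairs, so the entries are dependent. Grouping by edges gives a
combination of the weights themselves, to which the tail bounds for independent families apply. -/
theorem frob_similarityMatrix (w : Edge n d → ℝ) (f : Matrix (Fin n) (Fin n) ℝ) :
    frob (similarityMatrix w) f = ∑ e, pairSum f e * w e := by
  simp only [pairSum_eq_sum_ite, frob, similarityMatrix, Matrix.of_apply, Finset.sum_mul]
  rw [Finset.sum_comm' (t' := Finset.univ) (s' := fun _ => Finset.univ) (by simp)]
  conv_rhs => rw [Finset.sum_comm]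
  rw [Finset.sum_comm]
  refine Finset.sum_congr rfl fun i _ => ?_
  rw [Finset.sum_comm]
  refine Finset.sum_congr rfl fun j _ => ?_
  by_cases h : i = j
  · simp [h]
  · simp only [h, if_false, ne_eq, not_false_eq_true, true_and, Finset.sum_mul]
    refine Finset.sum_congr rfl fun e _ => ?_
    split_ifs <;> ring

theorem sum_pairSum_le (hd : 2 ≤ d) {f : Matrix (Fin n) (Fin n) ℝ} (hf : ∀ i j, 0 ≤ f i j) :
    ∑ e : Edge n d, pairSum f e ≤ (n : ℝ) ^ (d - 2) * ∑ i, ∑ j, f i j := by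
  simp only [pairSum_eq_sum_ite]
  rw [Finset.sum_comm, Finset.mul_sum]
  refine Finset.sum_le_sum fun i _ => ?_
  rw [Finset.sum_comm, Finset.mul_sum]
  refine Finset.sum_le_sum fun j _ => ?_
  by_cases h : i = j
  · simp only [h, ne_eq, not_true_eq_false, false_and, if_false, Finset.sum_const_zero]
    have := hf j j
    positivity
  · simp only [h, ne_eq, not_false_eq_true, true_and]
    rw [← Finset.sum_filter, Finset.sum_const, nsmul_eq_mul]
    have hq := card_edges_through (d := d) hd Finset.univ h (Finset.mem_univ i)
      (Finset.mem_univ j)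
    simp only [Finset.subset_univ, and_true, Finset.card_univ, Fintype.card_fin] at hq
    rw [hq]
    refine mul_le_mul_of_nonneg_right ?_ (hf i j)
    exact_mod_cast (Nat.choose_le_pow _ _).trans (Nat.pow_le_pow_left (Nat.sub_le _ _) _)

theorem abs_pairSum_le {f : Matrix (Fin n) (Fin n) ℝ} {F : ℝ} (hF : 0 ≤ F)
    (hf : ∀ i j, |f i j| ≤ F) (e : Edge n d) : |pairSum f e| ≤ (d : ℝ) ^ 2 * F := by
  refine (Finset.abs_sum_le_sum_abs _ _).trans ?_
  refine (Finset.sum_le_card_nsmul _ _ F fun x _ => hf _ _).trans ?_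
  rw [nsmul_eq_mul]
  exact mul_le_mul_of_nonneg_right (card_offDiag_le e) hF

theorem pairSum_sq_le (f : Matrix (Fin n) (Fin n) ℝ) (e : Edge n d) :
    pairSum f e ^ 2 ≤ (d : ℝ) ^ 2 * pairSum (Matrix.of fun i j => f i j ^ 2) e := by
  refine (sq_sum_le_card_mul_sum_sq).trans ?_
  exact mul_le_mul_of_nonneg_right (card_offDiag_le e)
    (Finset.sum_nonneg fun _ _ => sq_nonneg _)

end PairSum

section Tails

variable {n d : ℕ} {Ω : Type*} [MeasurableSpace Ω] {ρ : ℝ} {μ : Measure Ω}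
  [IsProbabilityMeasure μ] {w : Edge n d → Ω → ℝ}

/-- The similarity matrix of the weights minus its mean. -/
def centeredSimilarity (μ : Measure Ω) (w : Edge n d → Ω → ℝ) (ω : Ω) :
    Matrix (Fin n) (Fin n) ℝ :=
  similarityMatrix fun e => w e ω - ∫ ω, w e ω ∂μ

/-- Chernoff's bound with `K = d²` and `L = l / d²`. The threshold is arranged so that the failure
exponent `b` is free, to be chosen as the entropy that a union bound needs. -/
theorem IsBoundedFamily.measure_frob_ge_le (h : IsBoundedFamily ρ μ w) (hd : 2 ≤ d)
    (hρ : 0 ≤ ρ) {f : Matrix (Fin n) (Fin n) ℝ} (hf0 : ∀ i j, 0 ≤ f i j) (hf1 : ∀ i j, f i j ≤ 1)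
    {l : ℝ} (hl : 0 < l) (b : ℝ) :
    μ.real {ω | ρ * (n : ℝ) ^ (d - 2) * (∑ i, ∑ j, f i j) * Real.exp l + (d : ℝ) ^ 2 * b
        ≤ l * frob (similarityMatrix fun e => w e ω) f} ≤ Real.exp (-b) := by
  set S := ∑ i, ∑ j, f i j with hS
  have hd0 : (0 : ℝ) < (d : ℝ) ^ 2 := by positivity
  have h1 := h.measure_sum_ge_le (c := pairSum f) (K := (d : ℝ) ^ 2) (L := l / (d : ℝ) ^ 2)
    (fun e => Finset.sum_nonneg fun _ _ => hf0 _ _)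
    (fun e => by
      simpa using (le_abs_self _).trans (abs_pairSum_le zero_le_one
        (fun i j => by rw [abs_of_nonneg (hf0 i j)]; exact hf1 i j) e)) hd0 (by positivity)
    ((ρ * (n : ℝ) ^ (d - 2) * S * Real.exp l + (d : ℝ) ^ 2 * b) / l)
  have h2 : {ω | ρ * (n : ℝ) ^ (d - 2) * S * Real.exp l + (d : ℝ) ^ 2 * b
        ≤ l * frob (similarityMatrix fun e => w e ω) f}
      = {ω | (ρ * (n : ℝ) ^ (d - 2) * S * Real.exp l + (d : ℝ) ^ 2 * b) / l
        ≤ ∑ e, pairSum f e * w e ω} := by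
    ext ω
    simp only [Set.mem_ofPred_eq, frob_similarityMatrix, div_le_iff₀ hl]
    rw [mul_comm l]
  rw [h2]
  refine h1.trans (Real.exp_le_exp.2 ?_)
  rw [div_mul_cancel₀ _ hd0.ne']
  have h3 : -(l / (d : ℝ) ^ 2) * ((ρ * (n : ℝ) ^ (d - 2) * S * Real.exp l + (d : ℝ) ^ 2 * b) / l)
      = -b - ρ * (n : ℝ) ^ (d - 2) * S * Real.exp l / (d : ℝ) ^ 2 := by
    field_simp
    ring
  have h4 : (∑ e, pairSum (d := d) f e) * (ρ * ((Real.exp l - 1) / (d : ℝ) ^ 2))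
      ≤ ((n : ℝ) ^ (d - 2) * S) * (ρ * (Real.exp l / (d : ℝ) ^ 2)) := by
    have hS0 : 0 ≤ S := Finset.sum_nonneg fun i _ => Finset.sum_nonneg fun j _ => hf0 i j
    have : 0 ≤ Real.exp l - 1 := sub_nonneg.2 (Real.one_le_exp hl.le)
    refine mul_le_mul (sum_pairSum_le hd hf0) ?_ (by positivity) (by positivity)
    gcongr
    linarith
  have h5 : ((n : ℝ) ^ (d - 2) * S) * (ρ * (Real.exp l / (d : ℝ) ^ 2))
    = ρ * (n : ℝ) ^ (d - 2) * S * Real.exp l / (d : ℝ) ^ 2 := by ring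
  linarith

theorem IsBoundedFamily.measure_frob_centered_ge_le (h : IsBoundedFamily ρ μ w) (hd : 2 ≤ d)
    (hρ : 0 ≤ ρ) {f : Matrix (Fin n) (Fin n) ℝ} {F : ℝ} (hF : 0 ≤ F) (hf : ∀ i j, |f i j| ≤ F)
    {L : ℝ} (hL : 0 ≤ L) (hLF : L * ((d : ℝ) ^ 2 * F) ≤ 1) (t : ℝ) :
    μ.real {ω | t ≤ frob (centeredSimilarity μ w ω) f}
      ≤ Real.exp (-L * t + L ^ 2 * (d : ℝ) ^ 2 * (ρ * (n : ℝ) ^ (d - 2))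
          * ∑ i, ∑ j, f i j ^ 2) := by
  have h1 := h.measure_sum_centered_ge_le (c := pairSum f) (abs_pairSum_le hF hf) hL hLF t
  simp only [centeredSimilarity, frob_similarityMatrix]
  refine h1.trans (Real.exp_le_exp.2 ?_)
  have h2 : ∑ e : Edge n d, pairSum f e ^ 2
      ≤ (d : ℝ) ^ 2 * ((n : ℝ) ^ (d - 2) * ∑ i, ∑ j, f i j ^ 2) := by
    refine (Finset.sum_le_sum fun e _ => pairSum_sq_le f e).trans ?_
    rw [← Finset.mul_sum]
    exact mul_le_mul_of_nonneg_left (sum_pairSum_le hd fun i j => sq_nonneg (f i j))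
      (by positivity)
  have h3 := mul_le_mul_of_nonneg_left h2 (mul_nonneg hρ (sq_nonneg L))
  linarith

end Tails

/-! ### Entropy terms and geometric sums over levels. -/

/-- Apply `log (1/y) ≤ 1/y - 1` at `y = √x`. Trading a logarithm for half a power turns the entropy
terms into geometric series. -/
theorem mul_one_sub_log_le {x : ℝ} (h0 : 0 < x) (h1 : x ≤ 1) :
    x * (1 - Real.log x) ≤ 2 * Real.sqrt x := by
  obtain ⟨y, hy, rfl⟩ : ∃ y : ℝ, 0 < y ∧ y ^ 2 = x :=
    ⟨Real.sqrt x, Real.sqrt_pos.2 h0, Real.sq_sqrt h0.le⟩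
  rw [Real.sqrt_sq hy.le, Real.log_pow]
  have h := Real.log_le_sub_one_of_pos (inv_pos.2 hy)
  rw [Real.log_inv] at h
  have h2 : y * y⁻¹ = 1 := mul_inv_cancel₀ hy.ne'
  have h3 : y * (1 - 2 * Real.log y) ≤ 2 := by
    have := mul_le_mul_of_nonneg_left h hy.le
    have hy1 : y ≤ 1 := by nlinarith
    nlinarith
  push_cast at h3 ⊢
  nlinarith

theorem le_sqrt_of_le_one {x : ℝ} (h0 : 0 ≤ x) (h1 : x ≤ 1) : x ≤ Real.sqrt x :=
  Real.le_sqrt_of_sq_le (by nlinarith)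

/-- `√(4 ^ s / X)` as long as `4 ^ s ≤ X`. -/
def levelWeight (X : ℝ) (s : ℕ) : ℝ := if (4 : ℝ) ^ s ≤ X then Real.sqrt (4 ^ s / X) else 0

theorem levelWeight_nonneg (X : ℝ) (s : ℕ) : 0 ≤ levelWeight X s := by
  unfold levelWeight
  split_ifs <;> positivity

theorem sum_two_pow_le (Y : ℝ) (hY : 0 ≤ Y) (m : ℕ) :
    ∑ s ∈ Finset.range m, (if (2 : ℝ) ^ s ≤ Y then (2 : ℝ) ^ s else 0) ≤ 2 * Y := by
  induction m with
  | zero => simpa using hY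
  | succ m ih =>
    rw [Finset.sum_range_succ]
    split_ifs with h
    · have h1 : ∑ s ∈ Finset.range m, (if (2 : ℝ) ^ s ≤ Y then (2 : ℝ) ^ s else 0)
          ≤ ∑ s ∈ Finset.range m, (2 : ℝ) ^ s :=
        Finset.sum_le_sum fun s _ => by split_ifs <;> simp
      have h2 := geom_sum_eq (by norm_num : (2 : ℝ) ≠ 1) m
      rw [h2] at h1
      linarith
    · linarith

/-- The weights are `2 ^ s / √X` up to the cut-off `2 ^ s ≤ √X`, so the sum is at most twice the
cut-off value. -/
theorem sum_levelWeight_le {X : ℝ} (hX : 0 < X) (m : ℕ) :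
    ∑ s ∈ Finset.range m, levelWeight X s ≤ 2 := by
  have hs : 0 < Real.sqrt X := Real.sqrt_pos.2 hX
  have h := sum_two_pow_le (Real.sqrt X) hs.le m
  have h4 : ∀ s : ℕ, (4 : ℝ) ^ s = (2 ^ s) ^ 2 := fun s => by
    rw [← pow_mul, mul_comm, pow_mul]; norm_num
  have h1 : ∀ s, levelWeight X s
      = (if (2 : ℝ) ^ s ≤ Real.sqrt X then (2 : ℝ) ^ s else 0) / Real.sqrt X := by
    intro s
    unfold levelWeight
    rw [h4, Real.sqrt_div (by positivity), Real.sqrt_sq (by positivity)]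
    have : (2 : ℝ) ^ s ≤ Real.sqrt X ↔ ((2 : ℝ) ^ s) ^ 2 ≤ X :=
      Real.le_sqrt' (by positivity)
    simp only [← this]
    split_ifs <;> simp
  simp only [h1, ← Finset.sum_div]
  rw [div_le_iff₀ hs]
  exact h

theorem sum_inv_sq_four_pow_le (m : ℕ) : ∑ s ∈ Finset.range m, 1 / ((4 : ℝ) ^ s) ^ 2 ≤ 2 := by
  have h : ∀ s : ℕ, 1 / ((4 : ℝ) ^ s) ^ 2 = (1 / 16) ^ s := fun s => by
    rw [← pow_mul, mul_comm, pow_mul, div_pow, one_pow]; norm_num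
  simp only [h]
  rw [geom_sum_eq (by norm_num)]
  have : (0 : ℝ) < (1 / 16) ^ m := by positivity
  rw [div_le_iff_of_neg (by norm_num)]
  linarith

section EntropyTerms

variable {N r u v : ℝ}

theorem one_le_log_div (hr : 0 < r) (h3 : 3 * r ≤ u * v) : 1 ≤ Real.log (u * v / r) := by
  rw [Real.le_log_iff_exp_le (div_pos (by linarith) hr), le_div_iff₀ hr]
  nlinarith [Real.exp_one_lt_d9]

/-- With `x = u / (r v) ≤ 1` and `l = log (u v / r) ≥ 1` one has `u v / r = x v²`, hence `log v⁴ = 2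
(l - log x)`, and `x (l - log x) ≤ l x (1 - log x) ≤ 2 l √x`. -/
theorem mul_log_pow_le (hr : 1 ≤ r) (hu : 1 ≤ u) (hv : 1 ≤ v) (h3 : 3 * r ≤ u * v)
    (huv : u ≤ r * v) :
    u / v * Real.log (v ^ 4) ≤ 4 * r * Real.sqrt (u / (r * v)) * Real.log (u * v / r) := by
  have hl := one_le_log_div (by linarith) h3
  set l := Real.log (u * v / r) with hldef
  set x := u / (r * v) with hx
  have hx0 : 0 < x := by positivity
  have hx1 : x ≤ 1 := (div_le_one (by positivity)).2 huv
  have h1 : Real.log (v ^ 4) = 2 * (l - Real.log x) := by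
    rw [hldef, hx, Real.log_div (by positivity) (by positivity),
      Real.log_div (by positivity) (by positivity), Real.log_mul (by positivity) (by positivity),
      Real.log_mul (by positivity) (by positivity), Real.log_pow]
    push_cast
    ring
  have h2 : u / v = r * x := by
    rw [hx]; field_simp
  have h4 := mul_one_sub_log_le hx0 hx1
  have hlx : Real.log x ≤ 0 := Real.log_nonpos hx0.le hx1
  rw [h1, h2]
  have h5 : x * (l - Real.log x) ≤ 2 * Real.sqrt x * l := by
    have : x * (l - Real.log x) ≤ x * (1 - Real.log x) * l := by
      nlinarith [mul_nonneg hx0.le (neg_nonneg.2 hlx)]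
    nlinarith
  nlinarith

theorem div_cube_le (hr : 1 ≤ r) (hu : 1 ≤ u) (hv : 1 ≤ v) (huv : u ≤ r * v) :
    u * v * (1 / v ^ 4) ≤ r * Real.sqrt (u / (r * v)) * (1 / v ^ 2) := by
  have hx1 : u / (r * v) ≤ 1 := (div_le_one (by positivity)).2 huv
  have h := le_sqrt_of_le_one (by positivity) hx1
  have h1 : u * v * (1 / v ^ 4) = r * (u / (r * v)) * (1 / v ^ 2) := by
    field_simp
  rw [h1]
  gcongr

/-- The same trade with `x = u v / (16 N)`; the bounds on `u` and `v` serve to make `x ≤ 1`. -/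
theorem mul_log_le (hr : 1 ≤ r) (hN : 1 ≤ N) (hu : 1 ≤ u) (hv : 1 ≤ v) (h3 : 3 * r ≤ u * v)
    (huN : u ≤ 4 * Real.sqrt N) (hvN : v ≤ 4 * Real.sqrt N) :
    u * v * Real.log N ≤ 48 * N * r *
      (Real.sqrt (u / (4 * Real.sqrt N)) * Real.sqrt (v / (4 * Real.sqrt N)))
        * Real.log (u * v / r) := by
  have hl := one_le_log_div (by linarith) h3
  set l := Real.log (u * v / r) with hldef
  have hsN : 0 < Real.sqrt N := Real.sqrt_pos.2 (by linarith)
  have hNN : Real.sqrt N * Real.sqrt N = N := Real.mul_self_sqrt (by linarith)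
  rw [← Real.sqrt_mul (by positivity)]
  have hq : u / (4 * Real.sqrt N) * (v / (4 * Real.sqrt N)) = u * v / (16 * N) := by
    rw [div_mul_div_comm]
    congr 1
    linear_combination 16 * hNN
  rw [hq]
  set x := u * v / (16 * N) with hx
  have hx0 : 0 < x := by positivity
  have hx1 : x ≤ 1 := by
    rw [hx, div_le_one (by positivity)]
    calc u * v ≤ (4 * Real.sqrt N) * (4 * Real.sqrt N) := by gcongr
      _ = 16 * N := by linear_combination 16 * hNN
  have h1 : Real.log N ≤ l + Real.log r - Real.log x := by
    rw [hldef, hx, Real.log_div (by positivity) (by positivity),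
      Real.log_div (by positivity) (by positivity),
      Real.log_mul (by norm_num : (16 : ℝ) ≠ 0) (by positivity)]
    have : 0 ≤ Real.log 16 := Real.log_nonneg (by norm_num)
    linarith
  have h2 : u * v = 16 * N * x := by
    rw [hx]; field_simp
  have h4 := mul_one_sub_log_le hx0 hx1
  have hlx : Real.log x ≤ 0 := Real.log_nonpos hx0.le hx1
  have hlr : Real.log r ≤ r := (Real.log_le_sub_one_of_pos (by linarith)).trans (by linarith)
  have hlr0 : 0 ≤ Real.log r := Real.log_nonneg hr
  have hsx := le_sqrt_of_le_one hx0.le hx1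
  have h5 : x * Real.log N ≤ 3 * r * Real.sqrt x * l := by
    calc x * Real.log N ≤ x * (l + Real.log r - Real.log x) := by gcongr
      _ ≤ (x * (1 - Real.log x) + x * r) * l := by
        nlinarith [mul_nonneg (mul_nonneg hx0.le (neg_nonneg.2 hlx)) (sub_nonneg.2 hl),
          mul_nonneg (mul_nonneg hx0.le (hlr0.trans hlr)) (sub_nonneg.2 hl),
          mul_le_mul_of_nonneg_left hlr hx0.le]
      _ ≤ (2 * Real.sqrt x * r + Real.sqrt x * r) * l := by
        refine mul_le_mul_of_nonneg_right ?_ (by linarith)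
        nlinarith [Real.sqrt_nonneg x]
      _ = _ := by ring
  rw [h2]
  calc 16 * N * x * Real.log N = 16 * N * (x * Real.log N) := by ring
    _ ≤ 16 * N * (3 * r * Real.sqrt x * l) := by gcongr
    _ = _ := by ring

/-- The contribution of a pair of level sets of sizes `a`, `a'` whose number `e` of edges obeys
a discrepancy bound. -/
theorem level_pair_le {a a' e b : ℝ} (hr : 1 ≤ r) (hN : 1 ≤ N) (hu : 1 ≤ u) (hv : 1 ≤ v)
    (h3 : 3 * r ≤ u * v) (huv : u ≤ r * v) (hvu : v ≤ r * u)
    (huN : u ≤ 4 * Real.sqrt N) (hvN : v ≤ 4 * Real.sqrt N) (ha : 0 ≤ a) (ha' : 0 ≤ a')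
    (hb : 0 ≤ b)
    (he : Real.log (u * v / r) * e ≤ r ^ 2 / N * (a * a') * Real.exp (Real.log (u * v / r))
      + b * ((a * Real.log (u ^ 4) + N * (1 / u ^ 4)) + (a' * Real.log (v ^ 4) + N * (1 / v ^ 4))
        + 15 * Real.log N)) :
    u * v * e ≤ r / N * ((a * u ^ 2) * (a' * v ^ 2)) + b * (r * (
      4 * (a' * v ^ 2) * Real.sqrt (u / (r * v)) + N * Real.sqrt (u / (r * v)) * (1 / v ^ 2)
      + 4 * (a * u ^ 2) * Real.sqrt (v / (r * u)) + N * Real.sqrt (v / (r * u)) * (1 / u ^ 2)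
      + 720 * N * (Real.sqrt (u / (4 * Real.sqrt N)) * Real.sqrt (v / (4 * Real.sqrt N))))) := by
  have hl := one_le_log_div (by linarith) h3
  have t1 := mul_log_pow_le hr hu hv h3 huv
  have t2 := div_cube_le hr hu hv huv
  have t1' := mul_log_pow_le hr hv hu (by linarith [mul_comm u v]) hvu
  have t2' := div_cube_le hr hv hu hvu
  have t3 := mul_log_le hr hN hu hv h3 huN hvN
  rw [Real.exp_log (by positivity)] at he
  rw [mul_comm v u] at t1' t2'
  set l := Real.log (u * v / r) with hldef
  set X := Real.sqrt (u / (r * v))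
  set X' := Real.sqrt (v / (r * u))
  set Y := Real.sqrt (u / (4 * Real.sqrt N)) * Real.sqrt (v / (4 * Real.sqrt N))
  have hX : 0 ≤ X := Real.sqrt_nonneg _
  have hX' : 0 ≤ X' := Real.sqrt_nonneg _
  have hl0 : 0 < l := by linarith
  -- The discrepancy bound controls `l * e`. Multiplying the goal by `l ≥ 1` lets each entropy term
  -- use its own factor `l`.
  refine le_of_mul_le_mul_left ?_ hl0
  have e1 : u * v * (l * e) ≤ u * v * (r ^ 2 / N * (a * a') * (u * v / r)
      + b * ((a * Real.log (u ^ 4) + N * (1 / u ^ 4)) + (a' * Real.log (v ^ 4) + N * (1 / v ^ 4))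
        + 15 * Real.log N)) := mul_le_mul_of_nonneg_left he (by positivity)
  have e2 : u * v * (r ^ 2 / N * (a * a') * (u * v / r))
      ≤ l * (r / N * ((a * u ^ 2) * (a' * v ^ 2))) := by
    have : u * v * (r ^ 2 / N * (a * a') * (u * v / r))
      = 1 * (r / N * ((a * u ^ 2) * (a' * v ^ 2))) := by
      field_simp
    rw [this]
    gcongr
  have e3 : u * v * (a' * Real.log (v ^ 4)) ≤ l * (r * (4 * (a' * v ^ 2) * X)) := by
    have : u * v * (a' * Real.log (v ^ 4)) = (a' * v ^ 2) * (u / v * Real.log (v ^ 4)) := by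
      field_simp
    rw [this]
    refine (mul_le_mul_of_nonneg_left t1 (by positivity)).trans_eq (by ring)
  have e3' : u * v * (a * Real.log (u ^ 4)) ≤ l * (r * (4 * (a * u ^ 2) * X')) := by
    have : u * v * (a * Real.log (u ^ 4)) = (a * u ^ 2) * (v / u * Real.log (u ^ 4)) := by
      field_simp
    rw [this]
    refine (mul_le_mul_of_nonneg_left t1' (by positivity)).trans_eq (by ring)
  have e4 : u * v * (N * (1 / v ^ 4)) ≤ l * (r * (N * X * (1 / v ^ 2))) := by
    calc u * v * (N * (1 / v ^ 4)) = N * (u * v * (1 / v ^ 4)) := by ring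
      _ ≤ N * (r * X * (1 / v ^ 2)) := by gcongr
      _ = 1 * (r * (N * X * (1 / v ^ 2))) := by ring
      _ ≤ _ := by gcongr
  have e4' : u * v * (N * (1 / u ^ 4)) ≤ l * (r * (N * X' * (1 / u ^ 2))) := by
    calc u * v * (N * (1 / u ^ 4)) = N * (u * v * (1 / u ^ 4)) := by ring
      _ ≤ N * (r * X' * (1 / u ^ 2)) := by gcongr
      _ = 1 * (r * (N * X' * (1 / u ^ 2))) := by ring
      _ ≤ _ := by gcongr
  have e5 : u * v * (15 * Real.log N) ≤ l * (r * (720 * N * Y)) := by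
    linarith
  have e6 := mul_le_mul_of_nonneg_left
    (add_le_add (add_le_add (add_le_add (add_le_add e3 e4) e3') e4') e5) hb
  linarith

end EntropyTerms

/-! ### Level sets, discrepancy and heavy pairs. -/

/-- The logarithm to base four of the absolute value of an integer. -/
def level (z : ℤ) : ℕ := Nat.log 4 z.natAbs

/-- At `0` the level defaults to `0` and this bound fails, which is why level sets exclude zero
entries. -/
theorem four_pow_level_le {z : ℤ} (hz : z ≠ 0) : (4 : ℝ) ^ level z ≤ |(z : ℝ)| := by
  have h := Nat.pow_log_le_self 4 (Int.natAbs_ne_zero.2 hz)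
  rw [← Int.cast_abs, ← Nat.cast_natAbs]
  exact_mod_cast h

theorem abs_le_four_pow_level (z : ℤ) : |(z : ℝ)| ≤ 4 * (4 : ℝ) ^ level z := by
  have h := (Nat.lt_pow_succ_log_self (by norm_num : 1 < 4) z.natAbs).le
  rw [← Int.cast_abs, ← Nat.cast_natAbs, ← pow_succ']
  exact_mod_cast h

/-- The entries of an integer vector of a given level. -/
def levelSet {n : ℕ} (z : Fin n → ℤ) (s : ℕ) : Finset (Fin n) :=
  Finset.univ.filter fun i => z i ≠ 0 ∧ level (z i) = s

/-- The number of edges between two vertex sets in a weighted graph. -/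
def edgeSum {n : ℕ} (A : Matrix (Fin n) (Fin n) ℝ) (I J : Finset (Fin n)) : ℝ :=
  ∑ i ∈ I, ∑ j ∈ J, A i j

/-- An upper bound for the logarithmic weight of a vertex set of level `s`;
`exp (-entropy)` has sum at most `1` over all sets. -/
def entropy {n : ℕ} (s : ℕ) (I : Finset (Fin n)) : ℝ :=
  (I.card : ℝ) * Real.log (((4 : ℝ) ^ s) ^ 4) + n * (1 / ((4 : ℝ) ^ s) ^ 4)

/-- The number of edges between any two vertex sets is bounded by a multiple of its mean plus an
entropy term, at every pair of levels below `m` whose product is at least `3 r`. -/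
def HasDiscrepancy {n : ℕ} (A : Matrix (Fin n) (Fin n) ℝ) (r b : ℝ) (m : ℕ) : Prop :=
  ∀ s < m, ∀ t < m, 3 * r ≤ 4 ^ s * 4 ^ t → ∀ I J : Finset (Fin n),
    Real.log (4 ^ s * 4 ^ t / r) * edgeSum A I J
      ≤ r ^ 2 / n * ((I.card : ℝ) * J.card) * Real.exp (Real.log (4 ^ s * 4 ^ t / r))
        + b * (entropy s I + entropy t J + 15 * Real.log n)

section Levels

variable {n : ℕ} {z : Fin n → ℤ}

theorem card_levelSet_mul_le (z : Fin n → ℤ) (s : ℕ) :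
    ((levelSet z s).card : ℝ) * ((4 : ℝ) ^ s) ^ 2 ≤ ∑ i ∈ levelSet z s, (z i : ℝ) ^ 2 := by
  rw [← nsmul_eq_mul]
  refine Finset.card_nsmul_le_sum _ _ _ fun i hi => ?_
  simp only [levelSet, Finset.mem_filter, Finset.mem_univ, true_and] at hi
  have h := four_pow_level_le hi.1
  rw [hi.2] at h
  rw [← sq_abs (z i : ℝ)]
  gcongr

theorem sum_levelSet {m : ℕ} (hm : ∀ i, level (z i) < m) (f : Fin n → ℝ) :
    ∑ s ∈ Finset.range m, ∑ i ∈ levelSet z s, f i = ∑ i, if z i ≠ 0 then f i else 0 := by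
  rw [← Finset.sum_filter, ← Finset.sum_fiberwise_of_maps_to (t := Finset.range m)
    (g := fun i => level (z i)) (fun i _ => Finset.mem_range.2 (hm i))]
  simp only [levelSet, Finset.filter_filter]

theorem sum_card_levelSet_mul_le {m : ℕ} (hm : ∀ i, level (z i) < m) :
    ∑ s ∈ Finset.range m, ((levelSet z s).card : ℝ) * ((4 : ℝ) ^ s) ^ 2
      ≤ ∑ i, (z i : ℝ) ^ 2 := by
  refine (Finset.sum_le_sum fun s _ => card_levelSet_mul_le z s).trans ?_
  rw [sum_levelSet hm]
  refine Finset.sum_le_sum fun i _ => ?_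
  split_ifs
  · exact le_rfl
  · positivity

theorem four_pow_le_of_levelSet_nonempty {s : ℕ} (hs : (levelSet z s).Nonempty)
    (hz : ∑ i, (z i : ℝ) ^ 2 ≤ 16 * n) : (4 : ℝ) ^ s ≤ 4 * Real.sqrt n := by
  obtain ⟨i, hi⟩ := hs
  simp only [levelSet, Finset.mem_filter, Finset.mem_univ, true_and] at hi
  have h := four_pow_level_le hi.1
  rw [hi.2] at h
  have h1 : (z i : ℝ) ^ 2 ≤ 16 * n :=
    (Finset.single_le_sum (f := fun i => (z i : ℝ) ^ 2) (fun i _ => sq_nonneg _)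
      (Finset.mem_univ i)).trans hz
  refine h.trans ?_
  refine abs_le_of_sq_le_sq (h1.trans_eq ?_) (by positivity)
  rw [mul_pow, Real.sq_sqrt (by positivity)]
  norm_num

end Levels

/-- In each entropy term the level weights sum to at most `2`; any remaining index is summed using
`∑ α`, `∑ β ≤ 16 N` or `∑ 16 ^ (-s) ≤ 2`. The coefficient is `3144 = 2 · 128 + 2 · 4 + 2880`. -/
theorem sum_level_weights_le {N r b q : ℝ} (hN : 1 ≤ N) (hr : 1 ≤ r) (hb : 0 ≤ b) (hq0 : 0 < q)
    {m : ℕ} {α β : ℕ → ℝ} (hα0 : ∀ s, 0 ≤ α s) (hβ0 : ∀ s, 0 ≤ β s)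
    (hαs : ∑ s ∈ Finset.range m, α s ≤ 16 * N) (hβs : ∑ s ∈ Finset.range m, β s ≤ 16 * N) :
    ∑ s ∈ Finset.range m, ∑ t ∈ Finset.range m,
      (r / N * (α s * β t) + b * (r * (
          4 * β t * levelWeight (r * 4 ^ t) s
          + N * levelWeight (r * 4 ^ t) s * (1 / ((4 : ℝ) ^ t) ^ 2)
          + 4 * α s * levelWeight (r * 4 ^ s) t
          + N * levelWeight (r * 4 ^ s) t * (1 / ((4 : ℝ) ^ s) ^ 2)
          + 720 * N * (levelWeight q s * levelWeight q t))))
      ≤ (256 + 3144 * b) * N * r := by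
  simp only [mul_add, Finset.sum_add_distrib]
  have hrt : ∀ t : ℕ, 0 < r * 4 ^ t := fun t => by positivity
  have b1 : ∑ s ∈ Finset.range m, ∑ t ∈ Finset.range m, r / N * (α s * β t)
      ≤ 256 * N * r := by
    simp only [← Finset.mul_sum, ← Finset.sum_mul]
    calc r / N * ((∑ s ∈ Finset.range m, α s) * ∑ t ∈ Finset.range m, β t)
        ≤ r / N * ((16 * N) * (16 * N)) := by
          have := Finset.sum_nonneg fun s (_ : s ∈ Finset.range m) => hβ0 s
          gcongr
      _ = 256 * N * r := by field_simp; ring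
  have b2 : ∀ γ : ℕ → ℝ, (∀ s, 0 ≤ γ s) → ∑ s ∈ Finset.range m, γ s ≤ 16 * N →
      ∑ s ∈ Finset.range m, ∑ t ∈ Finset.range m,
        b * (r * (4 * γ s * levelWeight (r * 4 ^ s) t)) ≤ 128 * b * N * r := by
    intro γ h0 hγ
    simp only [← Finset.mul_sum]
    calc b * (r * ∑ s ∈ Finset.range m, 4 * γ s *
            ∑ t ∈ Finset.range m, levelWeight (r * 4 ^ s) t)
        ≤ b * (r * ∑ s ∈ Finset.range m, 4 * γ s * 2) := by
          gcongr with s _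
          · have := h0 s
            positivity
          · exact sum_levelWeight_le (hrt s) m
      _ = b * (r * (8 * ∑ s ∈ Finset.range m, γ s)) := by
          rw [← Finset.sum_mul, ← Finset.mul_sum]
          ring
      _ ≤ b * (r * (8 * (16 * N))) := by gcongr
      _ = _ := by ring
  have b3 : ∑ s ∈ Finset.range m, ∑ t ∈ Finset.range m,
        b * (r * (N * levelWeight (r * 4 ^ s) t * (1 / ((4 : ℝ) ^ s) ^ 2)))
      ≤ 4 * b * N * r := by
    calc ∑ s ∈ Finset.range m, ∑ t ∈ Finset.range m,
          b * (r * (N * levelWeight (r * 4 ^ s) t * (1 / ((4 : ℝ) ^ s) ^ 2)))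
        = b * (r * (N * ∑ s ∈ Finset.range m, (1 / ((4 : ℝ) ^ s) ^ 2) *
            ∑ t ∈ Finset.range m, levelWeight (r * 4 ^ s) t)) := by
          simp only [Finset.mul_sum]
          refine Finset.sum_congr rfl fun _ _ => Finset.sum_congr rfl fun _ _ => by ring
      _ ≤ b * (r * (N * ∑ s ∈ Finset.range m, (1 / ((4 : ℝ) ^ s) ^ 2) * 2)) := by
          gcongr with s _
          exact sum_levelWeight_le (hrt s) m
      _ ≤ b * (r * (N * (2 * 2))) := by
          rw [← Finset.sum_mul]
          gcongr
          exact sum_inv_sq_four_pow_le m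
      _ = _ := by ring
  have b4 : ∑ s ∈ Finset.range m, ∑ t ∈ Finset.range m,
        b * (r * (720 * N * (levelWeight q s * levelWeight q t))) ≤ 2880 * b * N * r := by
    simp only [← Finset.mul_sum, ← Finset.sum_mul]
    have h := sum_levelWeight_le hq0 m
    have h0 : 0 ≤ ∑ s ∈ Finset.range m, levelWeight q s :=
      Finset.sum_nonneg fun s _ => levelWeight_nonneg q s
    calc b * (r * (720 * N * ((∑ s ∈ Finset.range m, levelWeight q s)
            * ∑ s ∈ Finset.range m, levelWeight q s)))
        ≤ b * (r * (720 * N * (2 * 2))) := by gcongr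
      _ = _ := by ring
  have b2' := b2 α hα0 hαs
  have b2'' := b2 β hβ0 hβs
  have b3' := b3
  rw [Finset.sum_comm] at b2'' b3'
  linarith

/-- The deterministic bound for the heavy pairs in the middle range. -/
theorem sum_middle_level_pairs_le {n : ℕ} (hn : 1 ≤ n) {A : Matrix (Fin n) (Fin n) ℝ}
    {r b : ℝ} (hr : 1 ≤ r) (hb : 0 ≤ b) {m : ℕ}
    (hA : HasDiscrepancy A r b m) {z y : Fin n → ℤ} (hz : ∑ i, (z i : ℝ) ^ 2 ≤ 16 * n)
    (hy : ∑ i, (y i : ℝ) ^ 2 ≤ 16 * n) (hzm : ∀ i, level (z i) < m) (hym : ∀ i, level (y i) < m) :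
    ∑ s ∈ Finset.range m, ∑ t ∈ Finset.range m,
      (if 3 * r ≤ 4 ^ s * 4 ^ t ∧ (4 : ℝ) ^ s ≤ r * 4 ^ t ∧ (4 : ℝ) ^ t ≤ r * 4 ^ s then
        4 ^ s * 4 ^ t * edgeSum A (levelSet z s) (levelSet y t) else 0)
      ≤ (256 + 3144 * b) * n * r := by
  have hn1 : (1 : ℝ) ≤ n := by exact_mod_cast hn
  have h4 : ∀ s : ℕ, (1 : ℝ) ≤ 4 ^ s := fun s => one_le_pow₀ (by norm_num)
  set α : ℕ → ℝ := fun s => ((levelSet z s).card : ℝ) * ((4 : ℝ) ^ s) ^ 2 with hα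
  set β : ℕ → ℝ := fun s => ((levelSet y s).card : ℝ) * ((4 : ℝ) ^ s) ^ 2 with hβ
  set q : ℝ := 4 * Real.sqrt n with hq
  have hq0 : 0 < q := by positivity
  have hα0 : ∀ s, 0 ≤ α s := fun s => by positivity
  have hβ0 : ∀ s, 0 ≤ β s := fun s => by positivity
  have hαs : ∑ s ∈ Finset.range m, α s ≤ 16 * n := (sum_card_levelSet_mul_le hzm).trans hz
  have hβs : ∑ s ∈ Finset.range m, β s ≤ 16 * n := (sum_card_levelSet_mul_le hym).trans hy
  have hpt : ∀ s ∈ Finset.range m, ∀ t ∈ Finset.range m,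
      (if 3 * r ≤ 4 ^ s * 4 ^ t ∧ (4 : ℝ) ^ s ≤ r * 4 ^ t ∧ (4 : ℝ) ^ t ≤ r * 4 ^ s then
        4 ^ s * 4 ^ t * edgeSum A (levelSet z s) (levelSet y t) else 0)
      ≤ r / n * (α s * β t) + b * (r * (
          4 * β t * levelWeight (r * 4 ^ t) s
          + n * levelWeight (r * 4 ^ t) s * (1 / ((4 : ℝ) ^ t) ^ 2)
          + 4 * α s * levelWeight (r * 4 ^ s) t
          + n * levelWeight (r * 4 ^ s) t * (1 / ((4 : ℝ) ^ s) ^ 2)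
          + 720 * n * (levelWeight q s * levelWeight q t))) := by
    intro s hs t ht
    have hW := levelWeight_nonneg
    have hrhs : 0 ≤ r / n * (α s * β t) + b * (r * (
          4 * β t * levelWeight (r * 4 ^ t) s
          + n * levelWeight (r * 4 ^ t) s * (1 / ((4 : ℝ) ^ t) ^ 2)
          + 4 * α s * levelWeight (r * 4 ^ s) t
          + n * levelWeight (r * 4 ^ s) t * (1 / ((4 : ℝ) ^ s) ^ 2)
          + 720 * n * (levelWeight q s * levelWeight q t))) := by
      have := hW (r * 4 ^ t) s
      have := hW (r * 4 ^ s) t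
      have := hW q s
      have := hW q t
      have := hα0 s
      have := hβ0 t
      positivity
    split_ifs with h
    · obtain ⟨h3, hst, hts⟩ := h
      -- Only a nonempty level set yields `4 ^ s ≤ 4 √n`, which the `log n` term requires.
      rcases (levelSet z s).eq_empty_or_nonempty with h0 | hzs
      · simp only [h0, edgeSum, Finset.sum_empty, mul_zero]
        exact hrhs
      rcases (levelSet y t).eq_empty_or_nonempty with h0 | hyt
      · simp only [h0, edgeSum, Finset.sum_empty, Finset.sum_const_zero, mul_zero]
        exact hrhs
      have hsq := four_pow_le_of_levelSet_nonempty hzs hz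
      have htq := four_pow_le_of_levelSet_nonempty hyt hy
      have hd := hA s (Finset.mem_range.1 hs) t (Finset.mem_range.1 ht) h3 (levelSet z s)
        (levelSet y t)
      have e1 : levelWeight (r * 4 ^ t) s = Real.sqrt (4 ^ s / (r * 4 ^ t)) := if_pos hst
      have e2 : levelWeight (r * 4 ^ s) t = Real.sqrt (4 ^ t / (r * 4 ^ s)) := if_pos hts
      have e3 : levelWeight q s = Real.sqrt (4 ^ s / q) := if_pos hsq
      have e4 : levelWeight q t = Real.sqrt (4 ^ t / q) := if_pos htq
      rw [e1, e2, e3, e4]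
      exact level_pair_le hr hn1 (h4 s) (h4 t) h3 hst hts hsq htq (Nat.cast_nonneg _)
        (Nat.cast_nonneg _) hb hd
    · exact hrhs
  refine (Finset.sum_le_sum fun s hs => Finset.sum_le_sum (hpt s hs)).trans ?_
  exact sum_level_weights_le hn1 hr hb hq0 hα0 hβ0 hαs hβs

/-- The deterministic bound for all heavy pairs. -/
theorem sum_heavy_pairs_le {n : ℕ} (hn : 1 ≤ n) {A : Matrix (Fin n) (Fin n) ℝ}
    {r b c : ℝ} (hr : 1 ≤ r) (hb : 0 ≤ b) {m : ℕ} (hA0 : ∀ i j, 0 ≤ A i j)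
    (hA : HasDiscrepancy A r b m) (hrow : ∀ i, ∑ j, A i j ≤ c * r ^ 2)
    (hcol : ∀ j, ∑ i, A i j ≤ c * r ^ 2) (hc : 0 ≤ c)
    {z y : Fin n → ℤ} (hz : ∑ i, (z i : ℝ) ^ 2 ≤ 16 * n)
    (hy : ∑ i, (y i : ℝ) ^ 2 ≤ 16 * n) (hzm : ∀ i, level (z i) < m) (hym : ∀ i, level (y i) < m) :
    ∑ i, ∑ j, (if 3 * r ≤ 4 ^ level (z i) * 4 ^ level (y j) then
        A i j * (|(z i : ℝ)| * |(y j : ℝ)|) else 0)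
      ≤ (4096 + 50304 * b + 128 * c) * n * r := by
  have h4 : ∀ s : ℕ, (0 : ℝ) < 4 ^ s := fun s => by positivity
  have hr0 : 0 < r := by linarith
  have hpt : ∀ i j, (if 3 * r ≤ 4 ^ level (z i) * 4 ^ level (y j) then
        A i j * (|(z i : ℝ)| * |(y j : ℝ)|) else 0)
      ≤ 4 / r * (A i j * (z i : ℝ) ^ 2) + 4 / r * (A i j * (y j : ℝ) ^ 2)
        + 16 * (if z i ≠ 0 then (if y j ≠ 0 then
          (if 3 * r ≤ 4 ^ level (z i) * 4 ^ level (y j) ∧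
            (4 : ℝ) ^ level (z i) ≤ r * 4 ^ level (y j) ∧
            (4 : ℝ) ^ level (y j) ≤ r * 4 ^ level (z i) then
          4 ^ level (z i) * 4 ^ level (y j) * A i j else 0) else 0) else 0) := by
    intro i j
    have hAij := hA0 i j
    have hzu := abs_le_four_pow_level (z i)
    have hyv := abs_le_four_pow_level (y j)
    have n1 : 0 ≤ 4 / r * (A i j * (z i : ℝ) ^ 2) := by positivity
    have n2 : 0 ≤ 4 / r * (A i j * (y j : ℝ) ^ 2) := by positivity
    have n3 : 0 ≤ 4 ^ level (z i) * 4 ^ level (y j) * A i j :=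
      mul_nonneg (mul_pos (h4 _) (h4 _)).le hAij
    by_cases hz0 : z i = 0
    · simp only [hz0, Int.cast_zero, abs_zero, zero_mul, mul_zero, ite_self]
      positivity
    by_cases hy0 : y j = 0
    · simp only [hy0, Int.cast_zero, abs_zero, mul_zero, ite_self]
      positivity
    have huz := four_pow_level_le hz0
    have hvy := four_pow_level_le hy0
    simp only [ne_eq, hz0, hy0, not_false_eq_true, if_true]
    set u : ℝ := 4 ^ level (z i)
    set v : ℝ := 4 ^ level (y j)
    by_cases h3 : 3 * r ≤ u * v
    · rw [if_pos h3]
      by_cases huv : u ≤ r * v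
      · by_cases hvu : v ≤ r * u
        · rw [if_pos ⟨h3, huv, hvu⟩]
          have : A i j * (|(z i : ℝ)| * |(y j : ℝ)|) ≤ A i j * ((4 * u) * (4 * v)) := by
            gcongr
          linarith
        -- Lopsided pair: `v > r u` gives `r |z i| ≤ 4 |y j|`, so the product is charged to `(y j)²`
        -- alone and a column sum of order `r²` suffices. The case `u > r v` is symmetric.
        · rw [if_neg (by tauto)]
          have : A i j * (|(z i : ℝ)| * |(y j : ℝ)|) ≤ 4 / r * (A i j * (y j : ℝ) ^ 2) := by
            rw [div_mul_eq_mul_div, le_div_iff₀ hr0, ← sq_abs (y j : ℝ)]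
            have h5 : r * |(z i : ℝ)| ≤ 4 * |(y j : ℝ)| := by nlinarith
            have h6 := mul_le_mul_of_nonneg_left h5
              (mul_nonneg hAij (abs_nonneg (y j : ℝ)))
            linarith
          linarith
      · rw [if_neg (by tauto)]
        have : A i j * (|(z i : ℝ)| * |(y j : ℝ)|) ≤ 4 / r * (A i j * (z i : ℝ) ^ 2) := by
          rw [div_mul_eq_mul_div, le_div_iff₀ hr0, ← sq_abs (z i : ℝ)]
          have h5 : r * |(y j : ℝ)| ≤ 4 * |(z i : ℝ)| := by nlinarith
          have h6 := mul_le_mul_of_nonneg_left h5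
            (mul_nonneg hAij (abs_nonneg (z i : ℝ)))
          linarith
        linarith
    · rw [if_neg h3, if_neg (by tauto)]
      linarith
  refine (Finset.sum_le_sum fun i _ => Finset.sum_le_sum fun j _ => hpt i j).trans ?_
  simp only [Finset.sum_add_distrib, ← Finset.mul_sum]
  have c1 : ∑ i, ∑ j, A i j * (z i : ℝ) ^ 2 ≤ c * r ^ 2 * (16 * n) := by
    simp only [← Finset.sum_mul]
    calc ∑ i, (∑ j, A i j) * (z i : ℝ) ^ 2 ≤ ∑ i, c * r ^ 2 * (z i : ℝ) ^ 2 := by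
          gcongr with i _
          exact hrow i
      _ ≤ _ := by
          rw [← Finset.mul_sum]
          gcongr
  have c2 : ∑ i, ∑ j, A i j * (y j : ℝ) ^ 2 ≤ c * r ^ 2 * (16 * n) := by
    rw [Finset.sum_comm]
    simp only [← Finset.sum_mul]
    calc ∑ j, (∑ i, A i j) * (y j : ℝ) ^ 2 ≤ ∑ j, c * r ^ 2 * (y j : ℝ) ^ 2 := by
          gcongr with i _
          exact hcol i
      _ ≤ _ := by
          rw [← Finset.mul_sum]
          gcongr
  have c3 : ∑ i, ∑ j, (if z i ≠ 0 then (if y j ≠ 0 then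
          (if 3 * r ≤ 4 ^ level (z i) * 4 ^ level (y j) ∧
            (4 : ℝ) ^ level (z i) ≤ r * 4 ^ level (y j) ∧
            (4 : ℝ) ^ level (y j) ≤ r * 4 ^ level (z i) then
          4 ^ level (z i) * 4 ^ level (y j) * A i j else 0) else 0) else 0)
      ≤ (256 + 3144 * b) * n * r := by
    refine le_trans (le_of_eq ?_) (sum_middle_level_pairs_le hn hr hb hA hz hy hzm hym)
    have e1 : ∀ i, (∑ j, (if z i ≠ 0 then (if y j ≠ 0 then
          (if 3 * r ≤ 4 ^ level (z i) * 4 ^ level (y j) ∧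
            (4 : ℝ) ^ level (z i) ≤ r * 4 ^ level (y j) ∧
            (4 : ℝ) ^ level (y j) ≤ r * 4 ^ level (z i) then
          4 ^ level (z i) * 4 ^ level (y j) * A i j else 0) else 0) else 0))
        = if z i ≠ 0 then ∑ j, (if y j ≠ 0 then
          (if 3 * r ≤ 4 ^ level (z i) * 4 ^ level (y j) ∧
            (4 : ℝ) ^ level (z i) ≤ r * 4 ^ level (y j) ∧
            (4 : ℝ) ^ level (y j) ≤ r * 4 ^ level (z i) then
          4 ^ level (z i) * 4 ^ level (y j) * A i j else 0) else 0) else 0 := by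
      intro i
      split_ifs <;> simp
    simp only [e1]
    rw [← sum_levelSet hzm]
    refine Finset.sum_congr rfl fun s _ => ?_
    simp only [← sum_levelSet hym]
    rw [Finset.sum_comm]
    refine Finset.sum_congr rfl fun t _ => ?_
    have e2 : ∀ i ∈ levelSet z s, ∀ j ∈ levelSet y t,
        (if 3 * r ≤ 4 ^ level (z i) * 4 ^ level (y j) ∧
            (4 : ℝ) ^ level (z i) ≤ r * 4 ^ level (y j) ∧
            (4 : ℝ) ^ level (y j) ≤ r * 4 ^ level (z i) then
          4 ^ level (z i) * 4 ^ level (y j) * A i j else 0)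
        = if 3 * r ≤ 4 ^ s * 4 ^ t ∧ (4 : ℝ) ^ s ≤ r * 4 ^ t ∧ (4 : ℝ) ^ t ≤ r * 4 ^ s then
          4 ^ s * 4 ^ t * A i j else 0 := by
      intro i hi j hj
      simp only [levelSet, Finset.mem_filter, Finset.mem_univ, true_and] at hi hj
      rw [hi.2, hj.2]
    rw [Finset.sum_congr rfl fun i hi => Finset.sum_congr rfl fun j hj => e2 i hi j hj]
    split_ifs
    · simp only [edgeSum, Finset.mul_sum]
    · simp
  have d1 : 4 / r * (c * r ^ 2 * (16 * n)) = 64 * c * n * r := by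
    field_simp
    ring
  have d2 : (0 : ℝ) ≤ 4 / r := by positivity
  have d3 := mul_le_mul_of_nonneg_left c1 d2
  have d4 := mul_le_mul_of_nonneg_left c2 d2
  linarith

/-! ### The lattice net. -/

/-- The integer vectors of squared norm at most `16 n`. -/
def latticeNet (n : ℕ) : Finset (Fin n → ℤ) :=
  (Fintype.piFinset fun _ => Finset.Icc (-(16 * n : ℤ)) (16 * n)).filter
    fun z => ∑ i, (z i : ℝ) ^ 2 ≤ 16 * n

section Net

variable {n : ℕ}

theorem abs_le_of_sum_sq_le {z : Fin n → ℤ} (hz : ∑ i, (z i : ℝ) ^ 2 ≤ 16 * n) (i : Fin n) :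
    |z i| ≤ 16 * n := by
  have h1 : (z i : ℝ) ^ 2 ≤ 16 * n :=
    (Finset.single_le_sum (f := fun i => (z i : ℝ) ^ 2) (fun i _ => sq_nonneg _)
      (Finset.mem_univ i)).trans hz
  have h2 : z i ^ 2 ≤ 16 * n := by exact_mod_cast h1
  have h3 := Int.le_self_sq |z i|
  rw [sq_abs] at h3
  exact h3.trans h2

theorem mem_latticeNet {z : Fin n → ℤ} : z ∈ latticeNet n ↔ ∑ i, (z i : ℝ) ^ 2 ≤ 16 * n := by
  simp only [latticeNet, Finset.mem_filter, Fintype.mem_piFinset, Finset.mem_Icc,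
    and_iff_right_iff_imp]
  exact fun h i => abs_le.1 (abs_le_of_sum_sq_le h i)

theorem level_lt {z : Fin n → ℤ} (hz : ∑ i, (z i : ℝ) ^ 2 ≤ 16 * n) (i : Fin n) :
    level (z i) < 16 * n + 1 := by
  have h := abs_le_of_sum_sq_le hz i
  have h2 : level (z i) ≤ (z i).natAbs := Nat.log_le_self _ _
  rw [← Int.natCast_natAbs] at h
  omega

theorem sum_half_pow_natAbs_le (m : ℕ) :
    ∑ z ∈ Finset.Icc (-(m : ℤ)) m, (1 / 2 : ℝ) ^ z.natAbs ≤ 3 := by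
  suffices h : ∑ z ∈ Finset.Icc (-(m : ℤ)) m, (1 / 2 : ℝ) ^ z.natAbs = 3 - 2 * (1 / 2) ^ m by
    rw [h]
    have : (0 : ℝ) < (1 / 2) ^ m := by positivity
    linarith
  induction m with
  | zero => norm_num
  | succ m ih =>
    have h1 : Finset.Icc (-((m + 1 : ℕ) : ℤ)) ((m + 1 : ℕ) : ℤ)
        = insert ((m + 1 : ℕ) : ℤ) (insert (-((m + 1 : ℕ) : ℤ)) (Finset.Icc (-(m : ℤ)) m)) := by
      ext x
      simp only [Finset.mem_insert, Finset.mem_Icc]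
      omega
    rw [h1, Finset.sum_insert, Finset.sum_insert, ih]
    · simp only [Int.natAbs_neg, Int.natAbs_natCast, pow_succ]
      ring
    · simp only [Finset.mem_Icc]
      omega
    · simp only [Finset.mem_insert, Finset.mem_Icc]
      omega

/-- For integers `|z| ≤ z²`, so every net vector satisfies `2 ^ (16 n) ∏ 2 ^ (-|z i|) ≥ 1`. Summed
over a box this weight factors, with each factor at most `3`. -/
theorem card_latticeNet_le (n : ℕ) : ((latticeNet n).card : ℝ) ≤ (2 ^ 16 * 3) ^ n := by
  have h1 : ∀ z ∈ latticeNet n, (1 : ℝ) ≤ (2 ^ 16) ^ n * ∏ i, (1 / 2 : ℝ) ^ (z i).natAbs := by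
    intro z hz
    rw [mem_latticeNet] at hz
    have h2 : ∑ i, (z i).natAbs ≤ 16 * n := by
      have : (∑ i, ((z i).natAbs : ℝ)) ≤ ∑ i, (z i : ℝ) ^ 2 := by
        refine Finset.sum_le_sum fun i _ => ?_
        have h3 := Int.le_self_sq |z i|
        rw [sq_abs] at h3
        rw [Nat.cast_natAbs]
        exact_mod_cast h3
      exact_mod_cast this.trans hz
    rw [Finset.prod_pow_eq_pow_sum, ← pow_mul, one_div, inv_pow, ← div_eq_mul_inv,
      one_le_div (by positivity)]
    exact pow_le_pow_right₀ (by norm_num) h2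
  calc ((latticeNet n).card : ℝ) = ∑ z ∈ latticeNet n, (1 : ℝ) := by simp
    _ ≤ ∑ z ∈ latticeNet n, (2 ^ 16) ^ n * ∏ i, (1 / 2 : ℝ) ^ (z i).natAbs :=
        Finset.sum_le_sum h1
    _ ≤ ∑ z ∈ Fintype.piFinset fun _ : Fin n => Finset.Icc (-(16 * n : ℤ)) (16 * n),
          (2 ^ 16) ^ n * ∏ i, (1 / 2 : ℝ) ^ (z i).natAbs :=
        Finset.sum_le_sum_of_subset_of_nonneg (Finset.filter_subset _ _)
          fun _ _ _ => by positivity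
    _ = (2 ^ 16) ^ n * ∏ _i : Fin n, ∑ z ∈ Finset.Icc (-(16 * n : ℤ)) (16 * n),
          (1 / 2 : ℝ) ^ z.natAbs := by
        rw [Finset.prod_univ_sum, Finset.mul_sum]
    _ ≤ (2 ^ 16) ^ n * ∏ _i : Fin n, (3 : ℝ) := by
        gcongr with i _
        exact_mod_cast sum_half_pow_natAbs_le (16 * n)
    _ = _ := by simp [mul_pow]

/-- Rounding towards zero. -/
def roundToZero (t : ℝ) : ℤ := if 0 ≤ t then ⌊t⌋ else ⌈t⌉

/-- Rounding towards zero never increases absolute values, so the approximant of a unit-ball vector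
stays in the ball. -/
theorem roundToZero_sq_le (t : ℝ) : (roundToZero t : ℝ) ^ 2 ≤ t ^ 2 := by
  unfold roundToZero
  split_ifs with h
  · have h1 := Int.floor_le t
    have h2 : (0 : ℝ) ≤ ⌊t⌋ := by exact_mod_cast Int.floor_nonneg.2 h
    nlinarith
  · have h1 := Int.le_ceil t
    have h2 : (⌈t⌉ : ℝ) ≤ 0 := by exact_mod_cast Int.ceil_le.2 (by push_cast; linarith)
    nlinarith

theorem sub_roundToZero_sq_le (t : ℝ) : (t - roundToZero t) ^ 2 ≤ 1 := by
  rw [sq_le_one_iff_abs_le_one, abs_le]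
  unfold roundToZero
  split_ifs with h
  · constructor <;> linarith [Int.floor_le t, Int.lt_floor_add_one t]
  · constructor <;> linarith [Int.le_ceil t, Int.ceil_lt_add_one t]

/-- Every vector of the unit ball is at distance at most `1 / 4` from a lattice vector scaled to
the unit ball. -/
theorem exists_lattice_approx (hn : 0 < n) {x : EuclideanSpace ℝ (Fin n)} (hx : ‖x‖ ≤ 1) :
    ∃ z : Fin n → ℤ, ∑ i, (z i : ℝ) ^ 2 ≤ 16 * n ∧
      ‖(WithLp.toLp 2 fun i => (z i : ℝ) / (4 * Real.sqrt n) : EuclideanSpace ℝ (Fin n))‖ ≤ 1 ∧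
      ‖x - WithLp.toLp 2 fun i => (z i : ℝ) / (4 * Real.sqrt n)‖ ≤ 1 / 4 := by
  have hn0 : (0 : ℝ) < n := by exact_mod_cast hn
  have hs : 0 < 4 * Real.sqrt n := by positivity
  have hs2 : (4 * Real.sqrt n) ^ 2 = 16 * n := by
    rw [mul_pow, Real.sq_sqrt hn0.le]; norm_num
  have hx2 : ∑ i, x i ^ 2 ≤ 1 := by
    rw [EuclideanSpace.norm_eq, Real.sqrt_le_one] at hx
    simpa using hx
  have hz : ∑ i, (roundToZero (4 * Real.sqrt n * x i) : ℝ) ^ 2 ≤ 16 * n := by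
    calc ∑ i, (roundToZero (4 * Real.sqrt n * x i) : ℝ) ^ 2
        ≤ ∑ i, (4 * Real.sqrt n * x i) ^ 2 :=
          Finset.sum_le_sum fun i _ => roundToZero_sq_le _
      _ = 16 * n * ∑ i, x i ^ 2 := by
          simp only [mul_pow _ (x _), hs2, Finset.mul_sum]
      _ ≤ 16 * n * 1 := by gcongr
      _ = _ := mul_one _
  refine ⟨fun i => roundToZero (4 * Real.sqrt n * x i), hz, ?_, ?_⟩
  · rw [EuclideanSpace.norm_eq, Real.sqrt_le_one]
    simp only [Real.norm_eq_abs, sq_abs, div_pow, hs2, ← Finset.sum_div]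
    rw [div_le_one (by positivity)]
    exact hz
  · rw [EuclideanSpace.norm_eq, Real.sqrt_le_left (by norm_num)]
    simp only [Real.norm_eq_abs, sq_abs, PiLp.sub_apply]
    calc ∑ i, (x i - (roundToZero (4 * Real.sqrt n * x i) : ℝ) / (4 * Real.sqrt n)) ^ 2
        ≤ ∑ _i : Fin n, 1 / (16 * (n : ℝ)) := by
          refine Finset.sum_le_sum fun i _ => ?_
          have h1 : x i - (roundToZero (4 * Real.sqrt n * x i) : ℝ) / (4 * Real.sqrt n)
            = (4 * Real.sqrt n * x i - roundToZero (4 * Real.sqrt n * x i))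
              / (4 * Real.sqrt n) := by
            field_simp
          rw [h1, div_pow, hs2]
          gcongr
          exact sub_roundToZero_sq_le _
      _ = (1 / 4) ^ 2 := by
          simp only [Finset.sum_const, Finset.card_univ, Fintype.card_fin, nsmul_eq_mul]
          field_simp
          norm_num

/-- A bound for a bilinear form on lattice vectors is, up to a factor, a bound for its
quadratic form. -/
theorem quadratic_form_le_of_lattice (hn : 0 < n) {M : Matrix (Fin n) (Fin n) ℝ} {C : ℝ}
    (hC : 0 ≤ C)
    (hM : ∀ z y : Fin n → ℤ, ∑ i, (z i : ℝ) ^ 2 ≤ 16 * n → ∑ i, (y i : ℝ) ^ 2 ≤ 16 * n →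
      ∑ i, ∑ j, M i j * ((z i : ℝ) * y j) ≤ C * n) (x : Fin n → ℝ) :
    ∑ i, ∑ j, M i j * (x i * x j) ≤ C / 8 * ∑ i, x i ^ 2 := by
  have hn0 : (0 : ℝ) < n := by exact_mod_cast hn
  have hs : 0 < 4 * Real.sqrt n := by positivity
  have hs2 : (4 * Real.sqrt n) * (4 * Real.sqrt n) = 16 * n := by
    rw [mul_mul_mul_comm, Real.mul_self_sqrt hn0.le]; norm_num
  set T : EuclideanSpace ℝ (Fin n) →L[ℝ] EuclideanSpace ℝ (Fin n) :=
    Matrix.toEuclideanCLM (𝕜 := ℝ) M with hT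
  have hB : ∀ a b : EuclideanSpace ℝ (Fin n),
      inner ℝ a (T b) = ∑ i, ∑ j, M i j * (a i * b j) := by
    intro a b
    simp only [hT, PiLp.inner_apply, Matrix.ofLp_toEuclideanCLM, Matrix.mulVec, dotProduct,
      RCLike.inner_apply, conj_trivial, Finset.sum_mul]
    exact Finset.sum_congr rfl fun i _ => Finset.sum_congr rfl fun j _ => by ring
  have hbil : ∀ a b : EuclideanSpace ℝ (Fin n), ‖a‖ ≤ 1 → ‖b‖ ≤ 1 →
      inner ℝ a (T b) ≤ C / 16 + ‖T‖ / 2 := by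
    intro a b ha hb
    obtain ⟨z, hz, hz1, hza⟩ := exists_lattice_approx hn ha
    obtain ⟨y, hy, hy1, hyb⟩ := exists_lattice_approx hn hb
    set a' : EuclideanSpace ℝ (Fin n) := WithLp.toLp 2 fun i => (z i : ℝ) / (4 * Real.sqrt n)
    set b' : EuclideanSpace ℝ (Fin n) := WithLp.toLp 2 fun i => (y i : ℝ) / (4 * Real.sqrt n)
    have h1 : inner ℝ a (T b)
        = inner ℝ a' (T b') + inner ℝ (a - a') (T b) + inner ℝ a' (T (b - b')) := by
      rw [map_sub, inner_sub_left, inner_sub_right]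
      ring
    have h2 : inner ℝ a' (T b') ≤ C / 16 := by
      rw [hB]
      have : ∑ i, ∑ j, M i j * (a' i * b' j)
          = (∑ i, ∑ j, M i j * ((z i : ℝ) * y j)) / (16 * n) := by
        simp only [Finset.sum_div]
        refine Finset.sum_congr rfl fun i _ => Finset.sum_congr rfl fun j _ => ?_
        simp only [a', b']
        rw [div_mul_div_comm, hs2]
        ring
      rw [this, div_le_iff₀ (by positivity)]
      refine (hM z y hz hy).trans_eq ?_
      ring
    have h3 : inner ℝ (a - a') (T b) ≤ ‖T‖ / 4 := by
      refine (real_inner_le_norm _ _).trans ?_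
      calc ‖a - a'‖ * ‖T b‖ ≤ 1 / 4 * (‖T‖ * 1) := by
            gcongr
            exact T.le_opNorm_of_le hb
        _ = _ := by ring
    have h4 : inner ℝ a' (T (b - b')) ≤ ‖T‖ / 4 := by
      refine (real_inner_le_norm _ _).trans ?_
      calc ‖a'‖ * ‖T (b - b')‖ ≤ 1 * (‖T‖ * (1 / 4)) := by
            gcongr
            exact T.le_opNorm_of_le hyb
        _ = _ := by ring
    linarith
  -- Testing with `a` in the direction of `T b` turns the bilinear bound into one for the norm; the
  -- approximation errors cost half the norm, which is absorbed to give `‖T‖ ≤ C / 8`.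
  have hK : ‖T‖ ≤ C / 16 + ‖T‖ / 2 := by
    refine ContinuousLinearMap.opNorm_le_of_unit_norm (by positivity) fun b hb => ?_
    by_cases h0 : ‖T b‖ = 0
    · rw [h0]; positivity
    have h1 := hbil (‖T b‖⁻¹ • T b) b (by rw [norm_smul, norm_inv, norm_norm, inv_mul_cancel₀ h0])
      hb.le
    rw [real_inner_smul_left, real_inner_self_eq_norm_sq, sq, ← mul_assoc, inv_mul_cancel₀ h0,
      one_mul] at h1
    exact h1
  have h1 := real_inner_le_norm (WithLp.toLp 2 x : EuclideanSpace ℝ (Fin n)) (T (WithLp.toLp 2 x))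
  rw [hB] at h1
  have h2 : ‖(WithLp.toLp 2 x : EuclideanSpace ℝ (Fin n))‖ ^ 2 = ∑ i, x i ^ 2 := by
    rw [EuclideanSpace.real_norm_sq_eq]
  rw [← h2]
  have h3 := T.le_opNorm (WithLp.toLp 2 x)
  refine h1.trans ?_
  have h4 := norm_nonneg (WithLp.toLp 2 x : EuclideanSpace ℝ (Fin n))
  calc _ ≤ ‖(WithLp.toLp 2 x : EuclideanSpace ℝ (Fin n))‖
        * (‖T‖ * ‖(WithLp.toLp 2 x : EuclideanSpace ℝ (Fin n))‖) := by gcongr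
    _ = ‖T‖ * ‖(WithLp.toLp 2 x : EuclideanSpace ℝ (Fin n))‖ ^ 2 := by ring
    _ ≤ _ := by
        gcongr
        linarith

end Net

/-! ### Spectral bound for the noise. -/

/-- The indicator matrix of `I × J`. -/
def rectangle {n : ℕ} (I J : Finset (Fin n)) : Matrix (Fin n) (Fin n) ℝ :=
  Matrix.of fun i j => if i ∈ I ∧ j ∈ J then 1 else 0

/-- The entries of `z yᵀ` at the light pairs. -/
def lightPart {n : ℕ} (r : ℝ) (z y : Fin n → ℤ) : Matrix (Fin n) (Fin n) ℝ :=
  Matrix.of fun i j => if 3 * r ≤ 4 ^ level (z i) * 4 ^ level (y j) then 0 else (z i : ℝ) * y j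

theorem frob_rectangle {n : ℕ} (A : Matrix (Fin n) (Fin n) ℝ) (I J : Finset (Fin n)) :
    frob A (rectangle I J) = edgeSum A I J := by
  simp only [frob, rectangle, Matrix.of_apply, mul_ite, mul_one, mul_zero, ite_and, edgeSum]
  rw [← Finset.sum_subset (Finset.subset_univ I)]
  · refine Finset.sum_congr rfl fun i hi => ?_
    simp [hi]
  · intro i _ hi
    simp [hi]

theorem sum_rectangle {n : ℕ} (I J : Finset (Fin n)) :
    ∑ i, ∑ j, rectangle I J i j = (I.card : ℝ) * J.card := by
  have h := frob_rectangle (Matrix.of fun _ _ => (1 : ℝ)) I J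
  simp only [frob, Matrix.of_apply, one_mul, edgeSum, Finset.sum_const, nsmul_eq_mul,
    mul_one] at h
  exact h

/-- With `a = 4 ^ (-4 s)` the sum is `(1 + a) ^ n exp (-n a)`. Thus `entropy` acts as a code length,
and a union bound over all vertex sets costs nothing beyond it. -/
theorem sum_exp_neg_entropy_le (n s : ℕ) :
    ∑ I : Finset (Fin n), Real.exp (-entropy s I) ≤ 1 := by
  set a : ℝ := 1 / ((4 : ℝ) ^ s) ^ 4 with ha
  have ha0 : 0 < a := by positivity
  have h1 : ∀ I : Finset (Fin n), Real.exp (-entropy s I)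
      = a ^ I.card * 1 ^ (Fintype.card (Fin n) - I.card) * Real.exp (-(n * a)) := by
    intro I
    have h2 : Real.log (((4 : ℝ) ^ s) ^ 4) = -Real.log a := by
      rw [ha, one_div, Real.log_inv, neg_neg]
    rw [entropy, h2, ← ha, neg_add, Real.exp_add, mul_neg, neg_neg, ← Real.log_pow,
      Real.exp_log (by positivity), one_pow, mul_one]
  simp only [h1]
  rw [← Finset.sum_mul, Fintype.sum_pow_mul_eq_add_pow, Fintype.card_fin, Real.exp_neg,
    ← div_eq_mul_inv, div_le_one (Real.exp_pos _), Real.exp_nat_mul]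
  gcongr
  exact Real.add_one_le_exp a

theorem exp_neg_mul_log {n : ℕ} (hn : 0 < n) (k : ℕ) :
    Real.exp (-(k * Real.log n)) = 1 / (n : ℝ) ^ k := by
  have : (0 : ℝ) < n := by exact_mod_cast hn
  rw [Real.exp_neg, ← Real.log_pow, Real.exp_log (by positivity), one_div]

section Events

variable {n d : ℕ} {Ω : Type*} [MeasurableSpace Ω] {ρ : ℝ} {μ : Measure Ω}
  [IsProbabilityMeasure μ] {w : Edge n d → Ω → ℝ}

theorem IsBoundedFamily.measure_edgeSum_ge_le (h : IsBoundedFamily ρ μ w) (hd : 2 ≤ d)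
    (hρ : 0 ≤ ρ) (I J : Finset (Fin n)) {l : ℝ} (hl : 0 < l) (b : ℝ) :
    μ.real {ω | ρ * (n : ℝ) ^ (d - 2) * ((I.card : ℝ) * J.card) * Real.exp l + (d : ℝ) ^ 2 * b
        ≤ l * edgeSum (similarityMatrix fun e => w e ω) I J} ≤ Real.exp (-b) := by
  have := h.measure_frob_ge_le hd hρ (f := rectangle I J)
    (fun i j => by simp only [rectangle, Matrix.of_apply]; split_ifs <;> norm_num)
    (fun i j => by simp only [rectangle, Matrix.of_apply]; split_ifs <;> norm_num) hl b
  simpa only [sum_rectangle, frob_rectangle] using this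

/-- Chernoff at `l = log (4 ^ s 4 ^ t / r)`, with failure exponent the two code lengths plus `15 log
n`. After summing over vertex sets only the at most `n ^ 4` pairs of levels remain to be paid for.
-/
theorem IsBoundedFamily.measure_not_hasDiscrepancy_le (h : IsBoundedFamily ρ μ w) (hd : 2 ≤ d)
    (hn : 20 ≤ n) (hρ : 0 ≤ ρ) {r : ℝ} (hr : 0 < r) (hr2 : ρ * (n : ℝ) ^ (d - 2) = r ^ 2 / n) :
    μ.real {ω | ¬ HasDiscrepancy (similarityMatrix fun e => w e ω) r ((d : ℝ) ^ 2) (16 * n + 1)}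
      ≤ 1 / (n : ℝ) ^ 11 := by
  set m := 16 * n + 1 with hm
  set ev : (ℕ × ℕ) × (Finset (Fin n) × Finset (Fin n)) → Set Ω := fun x =>
    {ω | 3 * r ≤ 4 ^ x.1.1 * 4 ^ x.1.2 ∧
      r ^ 2 / n * ((x.2.1.card : ℝ) * x.2.2.card) * Real.exp (Real.log (4 ^ x.1.1 * 4 ^ x.1.2 / r))
        + (d : ℝ) ^ 2 * (entropy x.1.1 x.2.1 + entropy x.1.2 x.2.2 + 15 * Real.log n)
      ≤ Real.log (4 ^ x.1.1 * 4 ^ x.1.2 / r)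
        * edgeSum (similarityMatrix fun e => w e ω) x.2.1 x.2.2} with hev
  have hsub : {ω | ¬ HasDiscrepancy (similarityMatrix fun e => w e ω) r ((d : ℝ) ^ 2) m}
      ⊆ ⋃ x ∈ (Finset.range m ×ˢ Finset.range m) ×ˢ
        (Finset.univ : Finset (Finset (Fin n) × Finset (Fin n))), ev x := by
    intro ω hω
    simp only [Set.mem_ofPred_eq, HasDiscrepancy, not_forall, not_le] at hω
    obtain ⟨s, hs, t, ht, h3, I, J, hlt⟩ := hω
    simp only [Set.mem_iUnion]
    exact ⟨((s, t), (I, J)), by simp [hs, ht], h3, hlt.le⟩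
  have hterm : ∀ x, μ.real (ev x) ≤ Real.exp (-entropy x.1.1 x.2.1)
      * Real.exp (-entropy x.1.2 x.2.2) * (1 / (n : ℝ) ^ 15) := by
    rintro ⟨⟨s, t⟩, ⟨I, J⟩⟩
    rw [← exp_neg_mul_log (by omega), ← Real.exp_add, ← Real.exp_add]
    by_cases h3 : 3 * r ≤ 4 ^ s * 4 ^ t
    · have := h.measure_edgeSum_ge_le hd hρ I J
        (zero_lt_one.trans_le (one_le_log_div hr h3))
        (entropy s I + entropy t J + 15 * Real.log n)
      rw [hr2] at this
      simp only [hev, h3, true_and]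
      refine this.trans_eq ?_
      congr 1
      push_cast
      ring
    · simp only [hev, h3, false_and]
      simp only [Set.ofPred_false, measureReal_empty]
      positivity
  refine (measureReal_mono hsub (measure_ne_top μ _)).trans ((measureReal_biUnion_finset_le _ _).trans
    ((Finset.sum_le_sum fun x _ => hterm x).trans ?_))
  rw [← Finset.sum_mul, Finset.sum_product]
  have hin : ∀ x : ℕ × ℕ, ∑ y : Finset (Fin n) × Finset (Fin n),
      Real.exp (-entropy x.1 y.1) * Real.exp (-entropy x.2 y.2) ≤ 1 := by
    intro x
    rw [← Finset.univ_product_univ, Finset.sum_product]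
    simp only [← Finset.mul_sum, ← Finset.sum_mul]
    exact mul_le_one₀ (sum_exp_neg_entropy_le n _)
      (Finset.sum_nonneg fun _ _ => (Real.exp_pos _).le) (sum_exp_neg_entropy_le n _)
  have hcount : ∑ x ∈ Finset.range m ×ˢ Finset.range m,
      ∑ y : Finset (Fin n) × Finset (Fin n),
      Real.exp (-entropy x.1 y.1) * Real.exp (-entropy x.2 y.2) ≤ (m : ℝ) * m := by
    refine (Finset.sum_le_sum fun x _ => hin x).trans ?_
    simp
  have hn' : (20 : ℝ) ≤ n := by exact_mod_cast hn
  have hm' : (m : ℝ) * m ≤ (n : ℝ) ^ 4 := by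
    rw [hm]
    push_cast
    have h1 : (16 * (n : ℝ) + 1) ≤ n ^ 2 := by nlinarith
    calc (16 * (n : ℝ) + 1) * (16 * n + 1) ≤ n ^ 2 * n ^ 2 := by gcongr
      _ = _ := by ring
  calc _ ≤ (n : ℝ) ^ 4 * (1 / (n : ℝ) ^ 15) := by
        gcongr
        exact hcount.trans hm'
    _ = _ := by
        field_simp

/-- Chernoff with `l = 1` and failure exponent `13 log n`; `log n ≤ r²` absorbs the logarithm, and
the `3` bounds `e`. -/
theorem IsBoundedFamily.measure_row_sum_gt_le (h : IsBoundedFamily ρ μ w) (hd : 2 ≤ d)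
    (hn : 20 ≤ n) (hρ : 0 ≤ ρ) {r : ℝ} (hr2 : ρ * (n : ℝ) ^ (d - 2) = r ^ 2 / n)
    (hlog : Real.log n ≤ r ^ 2) :
    μ.real {ω | ¬ ∀ i, ∑ j, similarityMatrix (fun e => w e ω) i j ≤ (3 + 13 * (d : ℝ) ^ 2) * r ^ 2}
      ≤ 1 / (n : ℝ) ^ 11 := by
  have hn' : (20 : ℝ) ≤ n := by exact_mod_cast hn
  have hsub : {ω | ¬ ∀ i, ∑ j, similarityMatrix (fun e => w e ω) i j
        ≤ (3 + 13 * (d : ℝ) ^ 2) * r ^ 2}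
      ⊆ ⋃ i ∈ (Finset.univ : Finset (Fin n)),
        {ω | ρ * (n : ℝ) ^ (d - 2) * ((({i} : Finset (Fin n)).card : ℝ) *
          (Finset.univ : Finset (Fin n)).card) * Real.exp 1 + (d : ℝ) ^ 2 * (13 * Real.log n)
        ≤ 1 * edgeSum (similarityMatrix fun e => w e ω) {i} Finset.univ} := by
    intro ω hω
    simp only [Set.mem_ofPred_eq, not_forall, not_le] at hω
    obtain ⟨i, hi⟩ := hω
    simp only [Set.mem_iUnion, Set.mem_ofPred_eq]
    refine ⟨i, Finset.mem_univ i, ?_⟩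
    rw [hr2]
    simp only [Finset.card_singleton, Nat.cast_one, one_mul, Finset.card_univ, Fintype.card_fin,
      edgeSum, Finset.sum_singleton]
    refine le_trans ?_ hi.le
    have h1 : r ^ 2 / n * n = r ^ 2 := by field_simp
    rw [h1]
    have h2 := Real.exp_one_lt_d9
    have h3 := mul_le_mul_of_nonneg_left hlog (sq_nonneg (d : ℝ))
    nlinarith [sq_nonneg r]
  refine (measureReal_mono hsub (measure_ne_top μ _)).trans ((measureReal_biUnion_finset_le _ _).trans
    ((Finset.sum_le_sum fun i _ => h.measure_edgeSum_ge_le hd hρ {i} Finset.univ one_pos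
      (13 * Real.log n)).trans ?_))
  have h4 := exp_neg_mul_log (n := n) (by omega) 13
  push_cast at h4
  rw [h4, Finset.sum_const, Finset.card_univ, Fintype.card_fin, nsmul_eq_mul, mul_one_div,
    div_le_div_iff₀ (by positivity) (by positivity), one_mul, ← pow_succ']
  exact pow_le_pow_right₀ (by linarith) (by norm_num)

theorem abs_lightPart_le {r : ℝ} (hr : 0 ≤ r) (z y : Fin n → ℤ) (i j : Fin n) :
    |lightPart r z y i j| ≤ 48 * r := by
  simp only [lightPart, Matrix.of_apply]
  split_ifs with h
  · simp [hr]
  · rw [abs_mul]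
    have h1 := abs_le_four_pow_level (z i)
    have h2 := abs_le_four_pow_level (y j)
    calc |(z i : ℝ)| * |(y j : ℝ)| ≤ (4 * 4 ^ level (z i)) * (4 * 4 ^ level (y j)) := by gcongr
      _ = 16 * (4 ^ level (z i) * 4 ^ level (y j)) := by ring
      _ ≤ 16 * (3 * r) := mul_le_mul_of_nonneg_left (not_le.1 h).le (by norm_num)
      _ = _ := by ring

theorem sum_lightPart_sq_le {r : ℝ} {z y : Fin n → ℤ} (hz : ∑ i, (z i : ℝ) ^ 2 ≤ 16 * n)
    (hy : ∑ i, (y i : ℝ) ^ 2 ≤ 16 * n) :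
    ∑ i, ∑ j, lightPart r z y i j ^ 2 ≤ 256 * (n : ℝ) ^ 2 := by
  calc ∑ i, ∑ j, lightPart r z y i j ^ 2 ≤ ∑ i, ∑ j, (z i : ℝ) ^ 2 * (y j : ℝ) ^ 2 := by
        refine Finset.sum_le_sum fun i _ => Finset.sum_le_sum fun j _ => ?_
        simp only [lightPart, Matrix.of_apply]
        split_ifs
        · rw [zero_pow two_ne_zero]
          positivity
        · rw [mul_pow]
    _ = (∑ i, (z i : ℝ) ^ 2) * ∑ j, (y j : ℝ) ^ 2 := by rw [Finset.sum_mul_sum]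
    _ ≤ (16 * n) * (16 * n) := by
        gcongr
    _ = _ := by ring

/-- Light entries are at most `48 r` and their squares sum to at most `256 n²`, so Bernstein at `L =
1 / (48 d² r)` fails with probability at most `exp (-39 n)`. This beats the at most `exp (28 n)`
pairs of net vectors. -/
theorem IsBoundedFamily.measure_light_gt_le (h : IsBoundedFamily ρ μ w) (hd : 2 ≤ d)
    (hn : 20 ≤ n) (hρ : 0 ≤ ρ) {r : ℝ} (hr : 0 < r) (hr2 : ρ * (n : ℝ) ^ (d - 2) = r ^ 2 / n) :
    μ.real {ω | ¬ ∀ z y : Fin n → ℤ, ∑ i, (z i : ℝ) ^ 2 ≤ 16 * n → ∑ i, (y i : ℝ) ^ 2 ≤ 16 * n →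
        frob (centeredSimilarity μ w ω) (lightPart r z y) ≤ 1920 * (d : ℝ) ^ 2 * n * r}
      ≤ 1 / (n : ℝ) ^ 11 := by
  have hn' : (20 : ℝ) ≤ n := by exact_mod_cast hn
  have hd0 : (0 : ℝ) < d := by exact_mod_cast (by omega : 0 < d)
  have hd1 : (1 : ℝ) ≤ (d : ℝ) ^ 2 := one_le_pow₀ (by exact_mod_cast (by omega : 1 ≤ d))
  set ev : (Fin n → ℤ) × (Fin n → ℤ) → Set Ω := fun x =>
    {ω | 1920 * (d : ℝ) ^ 2 * n * r ≤ frob (centeredSimilarity μ w ω) (lightPart r x.1 x.2)}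
    with hev
  have hsub : {ω | ¬ ∀ z y : Fin n → ℤ, ∑ i, (z i : ℝ) ^ 2 ≤ 16 * n →
        ∑ i, (y i : ℝ) ^ 2 ≤ 16 * n →
        frob (centeredSimilarity μ w ω) (lightPart r z y) ≤ 1920 * (d : ℝ) ^ 2 * n * r}
      ⊆ ⋃ x ∈ latticeNet n ×ˢ latticeNet n, ev x := by
    intro ω hω
    simp only [Set.mem_ofPred_eq, not_forall, not_le] at hω
    obtain ⟨z, y, hz, hy, hlt⟩ := hω
    simp only [Set.mem_iUnion]
    exact ⟨(z, y), Finset.mem_product.2 ⟨mem_latticeNet.2 hz, mem_latticeNet.2 hy⟩, hlt.le⟩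
  have hterm : ∀ x ∈ latticeNet n ×ˢ latticeNet n, μ.real (ev x) ≤ Real.exp (-(39 * n)) := by
    rintro ⟨z, y⟩ hx
    rw [Finset.mem_product, mem_latticeNet, mem_latticeNet] at hx
    have h1 := h.measure_frob_centered_ge_le hd hρ (f := lightPart r z y) (F := 48 * r)
      (by positivity) (abs_lightPart_le hr.le z y) (L := 1 / ((d : ℝ) ^ 2 * (48 * r)))
      (by positivity) (one_div_mul_cancel (by positivity)).le (1920 * (d : ℝ) ^ 2 * n * r)
    refine h1.trans (Real.exp_le_exp.2 ?_)
    rw [hr2]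
    have h2 := sum_lightPart_sq_le (r := r) hx.1 hx.2
    have h3 : -(1 / ((d : ℝ) ^ 2 * (48 * r))) * (1920 * (d : ℝ) ^ 2 * n * r) = -(40 * n) := by
      field_simp
      norm_num
    have h4 : (1 / ((d : ℝ) ^ 2 * (48 * r))) ^ 2 * (d : ℝ) ^ 2 * (r ^ 2 / n)
        * (256 * (n : ℝ) ^ 2) = (1 / 9) * n / (d : ℝ) ^ 2 := by
      field_simp
      norm_num
    have h5 : (1 / ((d : ℝ) ^ 2 * (48 * r))) ^ 2 * (d : ℝ) ^ 2 * (r ^ 2 / n)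
        * ∑ i, ∑ j, lightPart r z y i j ^ 2 ≤ (1 / 9) * n / (d : ℝ) ^ 2 := by
      rw [← h4]
      gcongr
    have h6 : (1 / 9) * (n : ℝ) / (d : ℝ) ^ 2 ≤ 1 * n := by
      rw [div_le_iff₀ (by positivity)]
      nlinarith
    rw [h3]
    linarith
  refine (measureReal_mono hsub (measure_ne_top μ _)).trans ((measureReal_biUnion_finset_le _ _).trans
    ((Finset.sum_le_sum hterm).trans ?_))
  rw [Finset.sum_const, Finset.card_product, nsmul_eq_mul]
  push_cast
  have hc := card_latticeNet_le n
  have he : (2 ^ 16 * 3 : ℝ) ≤ Real.exp 14 := by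
    have h1 : (2.7 : ℝ) ≤ Real.exp 1 := by linarith [Real.exp_one_gt_d9]
    have h2 : Real.exp 14 = Real.exp 1 ^ 14 := by rw [← Real.exp_nat_mul]; norm_num
    rw [h2]
    calc (2 ^ 16 * 3 : ℝ) ≤ 2.7 ^ 14 := by norm_num
      _ ≤ _ := by gcongr
  have hc2 : ((latticeNet n).card : ℝ) ≤ Real.exp (14 * n) := by
    refine hc.trans ?_
    rw [mul_comm (14 : ℝ), Real.exp_nat_mul]
    gcongr
  calc ((latticeNet n).card : ℝ) * (latticeNet n).card * Real.exp (-(39 * n))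
      ≤ Real.exp (14 * n) * Real.exp (14 * n) * Real.exp (-(39 * n)) := by gcongr
    _ = Real.exp (-(11 * n)) := by
        rw [← Real.exp_add, ← Real.exp_add]
        congr 1
        ring
    _ ≤ Real.exp (-((11 : ℕ) * Real.log n)) := by
        refine Real.exp_le_exp.2 ?_
        have := Real.log_le_sub_one_of_pos (by linarith : (0 : ℝ) < n)
        push_cast
        linarith
    _ = _ := exp_neg_mul_log (by omega) 11

theorem similarityMatrix_nonneg {v : Edge n d → ℝ} (hv : ∀ e, 0 ≤ v e) (i j : Fin n) :
    0 ≤ similarityMatrix v i j := by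
  simp only [similarityMatrix, Matrix.of_apply]
  split_ifs
  · exact le_rfl
  · exact Finset.sum_nonneg fun e _ => by split_ifs; exacts [hv e, le_rfl]

theorem similarityMatrix_symm (v : Edge n d → ℝ) (i j : Fin n) :
    similarityMatrix v i j = similarityMatrix v j i := by
  simp only [similarityMatrix, Matrix.of_apply, eq_comm (a := i), and_comm (a := i ∈ _)]

theorem similarityMatrix_sub (v v' : Edge n d → ℝ) (i j : Fin n) :
    similarityMatrix (fun e => v e - v' e) i j
      = similarityMatrix v i j - similarityMatrix v' i j := by
  simp only [similarityMatrix, Matrix.of_apply]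
  split_ifs
  · simp
  · rw [← Finset.sum_sub_distrib]
    exact Finset.sum_congr rfl fun e _ => by split_ifs <;> simp

theorem similarityMatrix_le (hd : 2 ≤ d) {v : Edge n d → ℝ} {ρ : ℝ} (hρ : 0 ≤ ρ)
    (hv : ∀ e, v e ≤ ρ) (i j : Fin n) :
    similarityMatrix v i j ≤ ρ * (n : ℝ) ^ (d - 2) := by
  simp only [similarityMatrix, Matrix.of_apply]
  split_ifs with hij
  · positivity
  · have hq := card_edges_through (d := d) hd Finset.univ hij (Finset.mem_univ i)
      (Finset.mem_univ j)
    simp only [Finset.subset_univ, and_true, Finset.card_univ, Fintype.card_fin] at hq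
    rw [← Finset.sum_filter]
    refine (Finset.sum_le_card_nsmul _ _ ρ fun e _ => hv e).trans ?_
    rw [hq, nsmul_eq_mul, mul_comm]
    refine mul_le_mul_of_nonneg_left ?_ hρ
    exact_mod_cast (Nat.choose_le_pow _ _).trans (Nat.pow_le_pow_left (Nat.sub_le _ _) _)

/-- A multiple, depending on `d` only, of the standard deviation that bounds the spectral norm of
the centered similarity matrix. -/
def spectralConst (d : ℕ) : ℝ := 4608 + 54000 * (d : ℝ) ^ 2

/-- Kahn and Szemerédi's bound for the centered similarity matrix. -/
theorem IsBoundedFamily.measure_quadratic_form_gt_le (h : IsBoundedFamily ρ μ w) (hd : 2 ≤ d)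
    (hn : 20 ≤ n) (hρ : 0 ≤ ρ) {r : ℝ} (hr : 1 ≤ r) (hr2 : ρ * (n : ℝ) ^ (d - 2) = r ^ 2 / n)
    (hlog : Real.log n ≤ r ^ 2) :
    μ.real {ω | ¬ ∀ x : Fin n → ℝ, ∑ i, ∑ j, centeredSimilarity μ w ω i j * (x i * x j)
        ≤ spectralConst d * r * ∑ i, x i ^ 2} ≤ 3 / (n : ℝ) ^ 11 := by
  have hn' : (20 : ℝ) ≤ n := by exact_mod_cast hn
  have hr0 : 0 < r := by linarith
  set E1 := {ω | ¬ HasDiscrepancy (similarityMatrix fun e => w e ω) r ((d : ℝ) ^ 2) (16 * n + 1)}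
  set E2 := {ω | ¬ ∀ i, ∑ j, similarityMatrix (fun e => w e ω) i j
    ≤ (3 + 13 * (d : ℝ) ^ 2) * r ^ 2}
  set E3 := {ω | ¬ ∀ z y : Fin n → ℤ, ∑ i, (z i : ℝ) ^ 2 ≤ 16 * n → ∑ i, (y i : ℝ) ^ 2 ≤ 16 * n →
        frob (centeredSimilarity μ w ω) (lightPart r z y) ≤ 1920 * (d : ℝ) ^ 2 * n * r}
  -- The weights lie in `[0, 1]` only almost surely, while the heavy-pair bound needs nonnegative
  -- entries pointwise.
  set E4 := {ω | ¬ ∀ e, w e ω ∈ Set.Icc (0 : ℝ) 1}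
  have h1 : μ.real E1 ≤ 1 / (n : ℝ) ^ 11 := h.measure_not_hasDiscrepancy_le hd hn hρ hr0 hr2
  have h2 : μ.real E2 ≤ 1 / (n : ℝ) ^ 11 := h.measure_row_sum_gt_le hd hn hρ hr2 hlog
  have h3 : μ.real E3 ≤ 1 / (n : ℝ) ^ 11 := h.measure_light_gt_le hd hn hρ hr0 hr2
  have h4 : μ.real E4 = 0 := by
    have : μ E4 = 0 := ae_iff.1 (ae_all_iff.2 h.mem_Icc)
    rw [measureReal_def, this, ENNReal.toReal_zero]
  have hsub : {ω | ¬ ∀ x : Fin n → ℝ, ∑ i, ∑ j, centeredSimilarity μ w ω i j * (x i * x j)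
        ≤ spectralConst d * r * ∑ i, x i ^ 2} ⊆ ((E1 ∪ E2) ∪ E3) ∪ E4 := by
    intro ω hω
    by_contra hcon
    simp only [E1, E2, E3, E4, Set.mem_union, Set.mem_ofPred_eq, not_or, not_not] at hcon hω
    obtain ⟨⟨⟨g1, g2⟩, g3⟩, g4⟩ := hcon
    apply hω
    have hA0 := similarityMatrix_nonneg fun e => (g4 e).1
    set A := similarityMatrix fun e => w e ω with hA
    set P := similarityMatrix fun e => ∫ ω, w e ω ∂μ with hP
    have hP1 : ∀ i j, P i j ≤ r ^ 2 / n := fun i j => by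
      rw [← hr2]
      exact similarityMatrix_le hd hρ h.mean_le i j
    have hP0 : ∀ i j, 0 ≤ P i j := similarityMatrix_nonneg fun e => (h.mean_mem_Icc e).1
    have hM : ∀ i j, centeredSimilarity μ w ω i j = A i j - P i j := fun i j =>
      similarityMatrix_sub _ _ i j
    have key := quadratic_form_le_of_lattice (n := n) (by omega)
      (M := centeredSimilarity μ w ω) (C := 8 * (spectralConst d * r))
      (by unfold spectralConst; positivity) ?_
    · intro x
      refine (key x).trans_eq ?_
      ring
    intro z y hz hy
    have l1 := g3 z y hz hy
    have l2 := sum_heavy_pairs_le (n := n) (by omega) hr (sq_nonneg (d : ℝ)) hA0 g1 g2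
      (fun j => by simp only [hA, similarityMatrix_symm _ _ j]; exact g2 j) (by positivity) hz hy
      (level_lt hz) (level_lt hy)
    have l3 : ∑ i, ∑ j, r / (3 * n) * ((z i : ℝ) ^ 2 * (y j : ℝ) ^ 2) ≤ 86 * n * r := by
      simp only [← Finset.mul_sum, ← Finset.sum_mul]
      calc r / (3 * n) * ((∑ i, (z i : ℝ) ^ 2) * ∑ j, (y j : ℝ) ^ 2)
          ≤ r / (3 * n) * ((16 * n) * (16 * n)) := by gcongr
        _ = 256 / 3 * (n * r) := by
            field_simp
            norm_num
        _ ≤ _ := by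
            have : 0 ≤ (n : ℝ) * r := by positivity
            linarith
    -- Light pairs keep the centring. At heavy pairs `A` and its mean are estimated separately,
    -- since the discrepancy property concerns `A` itself.
    have l4 : ∑ i, ∑ j, centeredSimilarity μ w ω i j * ((z i : ℝ) * y j)
        ≤ frob (centeredSimilarity μ w ω) (lightPart r z y)
          + ∑ i, ∑ j, (if 3 * r ≤ 4 ^ level (z i) * 4 ^ level (y j) then
            A i j * (|(z i : ℝ)| * |(y j : ℝ)|) else 0)
          + ∑ i, ∑ j, r / (3 * n) * ((z i : ℝ) ^ 2 * (y j : ℝ) ^ 2) := by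
      simp only [frob, ← Finset.sum_add_distrib]
      refine Finset.sum_le_sum fun i _ => Finset.sum_le_sum fun j _ => ?_
      simp only [lightPart, Matrix.of_apply]
      have hsq : 0 ≤ r / (3 * n) * ((z i : ℝ) ^ 2 * (y j : ℝ) ^ 2) := by positivity
      by_cases h3 : 3 * r ≤ 4 ^ level (z i) * 4 ^ level (y j)
      · rw [if_pos h3, if_pos h3, hM]
        by_cases hz0 : z i = 0
        · simp [hz0]
        by_cases hy0 : y j = 0
        · simp [hy0]
        have a1 : (z i : ℝ) * y j ≤ |(z i : ℝ)| * |(y j : ℝ)| := by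
          rw [← abs_mul]; exact le_abs_self _
        have a2 : -(|(z i : ℝ)| * |(y j : ℝ)|) ≤ (z i : ℝ) * y j := by
          rw [← abs_mul]; exact neg_abs_le _
        have a3 : 3 * r ≤ |(z i : ℝ)| * |(y j : ℝ)| :=
          h3.trans (mul_le_mul (four_pow_level_le hz0) (four_pow_level_le hy0) (by positivity)
            (abs_nonneg _))
        -- Heaviness means `3 r ≤ t`, so `(r² / n) t ≤ r t² / (3 n)`, and the sum of `t²` factors
        -- into two squared norms.
        have a4 : P i j * (|(z i : ℝ)| * |(y j : ℝ)|)
            ≤ r / (3 * n) * ((z i : ℝ) ^ 2 * (y j : ℝ) ^ 2) := by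
          rw [← sq_abs (z i : ℝ), ← sq_abs (y j : ℝ), ← mul_pow]
          set t := |(z i : ℝ)| * |(y j : ℝ)|
          have ht : 0 ≤ t := by positivity
          calc P i j * t ≤ r ^ 2 / n * t := by gcongr; exact hP1 i j
            _ = r / (3 * n) * (3 * r * t) := by field_simp
            _ ≤ r / (3 * n) * (t * t) := by gcongr
            _ = _ := by ring
        have a5 := mul_le_mul_of_nonneg_left a1 (hA0 i j)
        have a6 := mul_le_mul_of_nonneg_left a2 (hP0 i j)
        linarith
      · rw [if_neg h3, if_neg h3]
        linarith
    have hnr : 0 ≤ (n : ℝ) * r := by positivity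
    have hdnr : 0 ≤ (d : ℝ) ^ 2 * (n * r) := by positivity
    -- The three bounds add up to `(4566 + 53888 d²) n r`, already below `spectralConst d * r * n`;
    -- the factor `8` is slack.
    unfold spectralConst
    nlinarith
  refine (measureReal_mono hsub (measure_ne_top μ _)).trans ?_
  have u1 := measureReal_union_le (μ := μ) ((E1 ∪ E2) ∪ E3) E4
  have u2 := measureReal_union_le (μ := μ) (E1 ∪ E2) E3
  have u3 := measureReal_union_le (μ := μ) E1 E2
  have : 3 / (n : ℝ) ^ 11 = 1 / (n : ℝ) ^ 11 + 1 / (n : ℝ) ^ 11 + 1 / (n : ℝ) ^ 11 := by ring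
  linarith

end Events

/-! ### Deterministic analysis of the semidefinite program. -/

/-- The orthogonal projection onto the vectors that are constant on the communities. -/
def averaging {n k : ℕ} (Φ : Fin n → Fin k) : Matrix (Fin n) (Fin n) ℝ :=
  Matrix.of fun i j => if Φ i = Φ j then 1 / (clusterSize Φ (Φ i) : ℝ) else 0

section Deterministic

open scoped MatrixOrder Matrix.Norms.L2Operator

variable {n k : ℕ} {Φ : Fin n → Fin k}

theorem clusterMatrix_apply (i j : Fin n) :
    clusterMatrix Φ i j = if Φ i = Φ j then 1 else 0 := by
  simp [clusterMatrix, membershipMatrix, Matrix.mul_apply, eq_comm]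

theorem clusterSize_pos (i : Fin n) : 0 < clusterSize Φ (Φ i) :=
  Finset.card_pos.2 ⟨i, by simp⟩

theorem sum_averaging_mul {i : Fin n} {f : Fin n → ℝ} {c : ℝ} (hf : ∀ j, Φ j = Φ i → f j = c) :
    ∑ j, averaging Φ i j * f j = c := by
  have h1 : ∀ j, averaging Φ i j * f j
      = if Φ j = Φ i then 1 / (clusterSize Φ (Φ i) : ℝ) * c else 0 := by
    intro j
    simp only [averaging, Matrix.of_apply, eq_comm (a := Φ i)]
    split_ifs with h
    · rw [hf j h]
    · simp
  have h2 : (clusterSize Φ (Φ i) : ℝ) ≠ 0 := by exact_mod_cast (clusterSize_pos i).ne'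
  simp only [h1]
  rw [← Finset.sum_filter, Finset.sum_const, nsmul_eq_mul]
  change (clusterSize Φ (Φ i) : ℝ) * _ = _
  field_simp

theorem averaging_transpose : (averaging Φ).transpose = averaging Φ := by
  ext i j
  simp only [Matrix.transpose_apply, averaging, Matrix.of_apply]
  by_cases h : Φ i = Φ j
  · simp [h]
  · simp [h, Ne.symm h]

theorem averaging_mul_clusterMatrix : averaging Φ * clusterMatrix Φ = clusterMatrix Φ := by
  ext i j
  rw [Matrix.mul_apply]
  refine sum_averaging_mul fun l hl => ?_
  simp only [clusterMatrix_apply, hl]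

theorem averaging_mul_averaging : averaging Φ * averaging Φ = averaging Φ := by
  ext i j
  rw [Matrix.mul_apply]
  refine sum_averaging_mul fun l hl => ?_
  simp only [averaging, Matrix.of_apply, hl]

theorem sum_averaging (i : Fin n) : ∑ j, averaging Φ i j = 1 := by
  simpa using sum_averaging_mul (Φ := Φ) (i := i) (f := fun _ => 1) fun _ _ => rfl

theorem averaging_nonneg (i j : Fin n) : 0 ≤ averaging Φ i j := by
  simp only [averaging, Matrix.of_apply]
  split_ifs <;> positivity

theorem frob_eq_trace (M N : Matrix (Fin n) (Fin n) ℝ) : frob M N = (M.transpose * N).trace := by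
  simp only [frob, Matrix.trace, Matrix.diag, Matrix.mul_apply, Matrix.transpose_apply]
  rw [Finset.sum_comm]

theorem frob_mul_left (M N P : Matrix (Fin n) (Fin n) ℝ) :
    frob M (P * N) = frob (P.transpose * M) N := by
  rw [frob_eq_trace, frob_eq_trace, Matrix.transpose_mul, Matrix.transpose_transpose,
    Matrix.mul_assoc]

theorem frob_mul_right (M N P : Matrix (Fin n) (Fin n) ℝ) :
    frob M (N * P) = frob (M * P.transpose) N := by
  rw [frob_eq_trace, frob_eq_trace, Matrix.transpose_mul, Matrix.transpose_transpose,
    ← Matrix.mul_assoc, Matrix.trace_mul_comm, Matrix.mul_assoc]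

theorem frob_le_of_abs_le {M N : Matrix (Fin n) (Fin n) ℝ} {η : ℝ} (h : ∀ i j, |M i j| ≤ η) :
    |frob M N| ≤ η * ∑ i, ∑ j, |N i j| := by
  simp only [frob, Finset.mul_sum]
  refine (Finset.abs_sum_le_sum_abs _ _).trans (Finset.sum_le_sum fun i _ => ?_)
  refine (Finset.abs_sum_le_sum_abs _ _).trans (Finset.sum_le_sum fun j _ => ?_)
  rw [abs_mul]
  exact mul_le_mul_of_nonneg_right (h i j) (abs_nonneg _)

/-- `CᵀC` is the sum of the rank-one matrices of the rows of `C`, so a one-sided bound on the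
quadratic form is enough. -/
theorem frob_transpose_mul_self_le {M C : Matrix (Fin n) (Fin n) ℝ} {K : ℝ}
    (hM : ∀ x : Fin n → ℝ, ∑ i, ∑ j, M i j * (x i * x j) ≤ K * ∑ i, x i ^ 2) :
    frob M (C.transpose * C) ≤ K * (C.transpose * C).trace := by
  have h1 : frob M (C.transpose * C) = ∑ l, ∑ i, ∑ j, M i j * (C l i * C l j) := by
    simp only [frob, Matrix.mul_apply, Matrix.transpose_apply, Finset.mul_sum]
    rw [Finset.sum_comm]
    conv_rhs => rw [Finset.sum_comm]; enter [2, i]; rw [Finset.sum_comm]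
    rw [Finset.sum_comm]
  have h2 : (C.transpose * C).trace = ∑ l, ∑ i, C l i ^ 2 := by
    simp only [Matrix.trace, Matrix.diag, Matrix.mul_apply, Matrix.transpose_apply, sq]
    rw [Finset.sum_comm]
  rw [h1, h2, Finset.mul_sum]
  exact Finset.sum_le_sum fun l _ => hM (C l)

theorem clusterMatrix_mem_sdpFeasible : clusterMatrix Φ ∈ sdpFeasible n := by
  refine ⟨?_, ?_, ?_⟩
  · have := Matrix.posSemidef_self_mul_conjTranspose (membershipMatrix Φ)
    rwa [Matrix.conjTranspose_eq_transpose_of_trivial] at this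
  · simp only [frob, Matrix.one_apply, ite_mul, one_mul, zero_mul, Finset.sum_ite_eq,
      Finset.mem_univ, if_true, clusterMatrix_apply]
    simp
  · intro i j
    rw [clusterMatrix_apply]
    split_ifs <;> norm_num

theorem diag_eq_one_of_mem_sdpFeasible {Y : Matrix (Fin n) (Fin n) ℝ} (hY : Y ∈ sdpFeasible n)
    (i : Fin n) : Y i i = 1 := by
  have h1 : ∑ i, Y i i = n := by
    have := hY.2.1
    simpa [frob, Matrix.one_apply] using this
  have h2 : ∑ i, (1 - Y i i) = 0 := by
    rw [Finset.sum_sub_distrib, h1]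
    simp
  have h3 := (Finset.sum_eq_zero_iff_of_nonneg fun i _ =>
    sub_nonneg.2 (hY.2.2 i i).2).1 h2 i (Finset.mem_univ i)
  linarith

/-- Every part of the difference `Δ` that meets the range of the projection sees only averaged
noise. The rest is positive semidefinite with trace controlled by `‖Δ‖₁ / s`, so the spectral bound
enters divided by `s`. -/
theorem frob_sub_clusterMatrix_le {M Y : Matrix (Fin n) (Fin n) ℝ} (hY : Y ∈ sdpFeasible n)
    (hMsymm : M.transpose = M) {η K s : ℝ} (hK : 0 ≤ K) (hs : 0 < s)
    (hsize : ∀ i, s ≤ clusterSize Φ (Φ i))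
    (hblock : ∀ i j, |(averaging Φ * M) i j| ≤ η)
    (hM : ∀ x : Fin n → ℝ, ∑ i, ∑ j, M i j * (x i * x j) ≤ K * ∑ i, x i ^ 2) :
    frob M (Y - clusterMatrix Φ) ≤ (3 * η + K / s) * ∑ i, ∑ j, |(Y - clusterMatrix Φ) i j| := by
  set P := averaging Φ with hP
  set Δ := Y - clusterMatrix Φ with hΔ
  have hPt : P.transpose = P := averaging_transpose
  have hPP : P * P = P := averaging_mul_averaging
  have hdec : Δ = P * Δ + Δ * P - P * Δ * P + (1 - P) * Δ * (1 - P) := by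
    noncomm_ring
  -- The projection fixes the cluster matrix, so positivity of `Y` passes to this corner of `Δ`.
  have hZ : (1 - P) * Δ * (1 - P) = (1 - P) * Y * (1 - P) := by
    have : (1 - P) * clusterMatrix Φ = 0 := by
      rw [Matrix.sub_mul, Matrix.one_mul, hP, averaging_mul_clusterMatrix, sub_self]
    rw [hΔ, Matrix.mul_sub (1 - P) Y, this, sub_zero]
  have hfrob_add : ∀ N N' : Matrix (Fin n) (Fin n) ℝ, frob M (N + N') = frob M N + frob M N' := by
    intro N N'
    simp only [frob_eq_trace, Matrix.mul_add, Matrix.trace_add]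
  have hfrob_sub : ∀ N N' : Matrix (Fin n) (Fin n) ℝ, frob M (N - N') = frob M N - frob M N' := by
    intro N N'
    simp only [frob_eq_trace, Matrix.mul_sub, Matrix.trace_sub]
  have t1 : |frob M (P * Δ)| ≤ η * ∑ i, ∑ j, |Δ i j| := by
    rw [frob_mul_left, hPt]
    exact frob_le_of_abs_le hblock
  have t2 : |frob M (Δ * P)| ≤ η * ∑ i, ∑ j, |Δ i j| := by
    rw [frob_mul_right, hPt]
    refine frob_le_of_abs_le fun i j => ?_
    have : M * P = (P * M).transpose := by rw [Matrix.transpose_mul, hPt, hMsymm]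
    rw [this, Matrix.transpose_apply]
    exact hblock j i
  have t3 : |frob M (P * Δ * P)| ≤ η * ∑ i, ∑ j, |Δ i j| := by
    rw [frob_mul_right, frob_mul_left, hPt, ← Matrix.mul_assoc]
    refine frob_le_of_abs_le fun i j => ?_
    rw [Matrix.mul_apply]
    calc |∑ l, (P * M) i l * P l j| ≤ ∑ l, |(P * M) i l * P l j| :=
          Finset.abs_sum_le_sum_abs _ _
      _ ≤ ∑ l, η * P l j := by
          refine Finset.sum_le_sum fun l _ => ?_
          rw [abs_mul, abs_of_nonneg (averaging_nonneg l j)]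
          exact mul_le_mul_of_nonneg_right (hblock i l) (averaging_nonneg l j)
      _ = η := by
          rw [← Finset.mul_sum]
          have : ∑ l, P l j = 1 := by
            rw [← hPt]
            exact sum_averaging j
          rw [this, mul_one]
  have t4 : frob M ((1 - P) * Δ * (1 - P)) ≤ K * ((1 - P) * Y * (1 - P)).trace := by
    rw [hZ]
    obtain ⟨B, hB⟩ : ∃ B : Matrix (Fin n) (Fin n) ℝ, Y = B.transpose * B := by
      obtain ⟨B, hB⟩ := CStarAlgebra.nonneg_iff_eq_star_mul_self.1 hY.1.nonneg
      exact ⟨B, by rw [hB, Matrix.star_eq_conjTranspose,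
        Matrix.conjTranspose_eq_transpose_of_trivial]⟩
    have : (1 - P) * Y * (1 - P) = (B * (1 - P)).transpose * (B * (1 - P)) := by
      rw [hB, Matrix.transpose_mul, Matrix.transpose_sub, Matrix.transpose_one, hPt]
      simp only [Matrix.mul_assoc]
    rw [this]
    exact frob_transpose_mul_self_le hM
  -- The trace is `∑ P i j (1 - Y i j)`, because `Y` has unit diagonal and the rows of `P` sum to
  -- one; inside communities `1 - Y i j = |Δ i j|` and `P i j ≤ 1 / s`.
  have t5 : ((1 - P) * Y * (1 - P)).trace ≤ 1 / s * ∑ i, ∑ j, |Δ i j| := by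
    have e1 : ((1 - P) * Y * (1 - P)).trace = Y.trace - frob P Y := by
      rw [Matrix.trace_mul_comm, ← Matrix.mul_assoc, frob_eq_trace, hPt, ← Matrix.trace_sub]
      congr 1
      have : (1 - P) * (1 - P) = 1 - P := by
        rw [Matrix.mul_sub, Matrix.mul_one, Matrix.sub_mul, Matrix.one_mul, hPP, sub_self,
          sub_zero]
      rw [this, Matrix.sub_mul, Matrix.one_mul]
    have e2 : Y.trace = ∑ i, ∑ j, P i j := by
      simp only [Matrix.trace, Matrix.diag, diag_eq_one_of_mem_sdpFeasible hY, hP, sum_averaging]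
    rw [e1, e2, frob, ← Finset.sum_sub_distrib, Finset.mul_sum]
    refine Finset.sum_le_sum fun i _ => ?_
    rw [← Finset.sum_sub_distrib, Finset.mul_sum]
    refine Finset.sum_le_sum fun j _ => ?_
    have h1 := (hY.2.2 i j).2
    simp only [hΔ, hP, averaging, Matrix.of_apply, Matrix.sub_apply, clusterMatrix_apply]
    split_ifs with h
    · rw [abs_of_nonpos (by linarith)]
      have : 1 / (clusterSize Φ (Φ i) : ℝ) ≤ 1 / s := one_div_le_one_div_of_le hs (hsize i)
      nlinarith
    · simp only [sub_zero, zero_mul]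
      positivity
  have t6 := mul_le_mul_of_nonneg_left t5 hK
  have t7 : frob M Δ = frob M (P * Δ) + frob M (Δ * P) - frob M (P * Δ * P)
      + frob M ((1 - P) * Δ * (1 - P)) := by
    conv_lhs => rw [hdec]
    rw [hfrob_add, hfrob_sub, hfrob_add]
  rw [t7]
  have := (abs_le.1 t1).2
  have := (abs_le.1 t2).2
  have := (abs_le.1 t3).1
  have e : (3 * η + K / s) * ∑ i, ∑ j, |Δ i j|
      = 3 * (η * ∑ i, ∑ j, |Δ i j|) + K * (1 / s * ∑ i, ∑ j, |Δ i j|) := by ring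
  rw [e]
  linarith

/-- Deterministic conditions under which the semidefinite program recovers the communities. -/
theorem sdpSolutions_eq_singleton {A P M : Matrix (Fin n) (Fin n) ℝ} {l g η K s : ℝ}
    (hA : A = P + M) (hMsymm : M.transpose = M) (hK : 0 ≤ K) (hs : 0 < s)
    (hsize : ∀ i, s ≤ clusterSize Φ (Φ i))
    (hin : ∀ i j, i ≠ j → Φ i = Φ j → g ≤ P i j - l)
    (hout : ∀ i j, Φ i ≠ Φ j → g ≤ l - P i j)
    (hblock : ∀ i j, |(averaging Φ * M) i j| ≤ η)
    (hM : ∀ x : Fin n → ℝ, ∑ i, ∑ j, M i j * (x i * x j) ≤ K * ∑ i, x i ^ 2)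
    (hg : 3 * η + K / s < g) :
    sdpSolutions A l = {clusterMatrix Φ} := by
  -- The objective gap is at least a positive multiple of the distance to the cluster matrix, which
  -- gives optimality and uniqueness at once.
  have key : ∀ Y ∈ sdpFeasible n,
      (g - (3 * η + K / s)) * ∑ i, ∑ j, |(Y - clusterMatrix Φ) i j|
      ≤ frob (A - Matrix.of fun _ _ => l) (clusterMatrix Φ)
        - frob (A - Matrix.of fun _ _ => l) Y := by
    intro Y hY
    have h1 := frob_sub_clusterMatrix_le hY hMsymm hK hs hsize hblock hM
    have h2 : frob (A - Matrix.of fun _ _ => l) (clusterMatrix Φ)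
        - frob (A - Matrix.of fun _ _ => l) Y
        = (∑ i, ∑ j, (P i j - l) * -((Y - clusterMatrix Φ) i j))
          - frob M (Y - clusterMatrix Φ) := by
      simp only [frob, ← Finset.sum_sub_distrib, hA, Matrix.sub_apply, Matrix.add_apply,
        Matrix.of_apply]
      refine Finset.sum_congr rfl fun i _ => Finset.sum_congr rfl fun j _ => ?_
      ring
    have h3 : g * ∑ i, ∑ j, |(Y - clusterMatrix Φ) i j|
        ≤ ∑ i, ∑ j, (P i j - l) * -((Y - clusterMatrix Φ) i j) := by
      simp only [Finset.mul_sum]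
      refine Finset.sum_le_sum fun i _ => Finset.sum_le_sum fun j _ => ?_
      have hb := hY.2.2 i j
      rw [Matrix.sub_apply, clusterMatrix_apply]
      by_cases hij : i = j
      -- No hypothesis controls the diagonal of `P`; none is needed, as `Y` and the cluster matrix
      -- agree there.
      · subst hij
        simp [diag_eq_one_of_mem_sdpFeasible hY]
      · split_ifs with h
        · rw [abs_of_nonpos (by linarith)]
          exact mul_le_mul_of_nonneg_right (hin i j hij h) (by linarith)
        · rw [sub_zero, abs_of_nonneg hb.1]
          have := mul_le_mul_of_nonneg_right (hout i j h) hb.1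
          linarith
    linarith
  have hsum : ∀ Y : Matrix (Fin n) (Fin n) ℝ,
      0 ≤ ∑ i, ∑ j, |(Y - clusterMatrix Φ) i j| := fun Y =>
    Finset.sum_nonneg fun i _ => Finset.sum_nonneg fun j _ => abs_nonneg _
  ext Y
  simp only [sdpSolutions, Set.mem_ofPred_eq, Set.mem_singleton_iff]
  constructor
  · rintro ⟨hY, hopt⟩
    have h1 := key Y hY
    have h2 := hopt _ (clusterMatrix_mem_sdpFeasible (Φ := Φ))
    have h3 : ∑ i, ∑ j, |(Y - clusterMatrix Φ) i j| = 0 := by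
      have := hsum Y
      by_contra h0
      have : 0 < ∑ i, ∑ j, |(Y - clusterMatrix Φ) i j| := lt_of_le_of_ne this (Ne.symm h0)
      have := mul_pos (sub_pos.2 hg) this
      linarith
    ext i j
    have h4 := (Finset.sum_eq_zero_iff_of_nonneg fun i _ =>
      Finset.sum_nonneg fun j _ => abs_nonneg _).1 h3 i (Finset.mem_univ i)
    have h5 := (Finset.sum_eq_zero_iff_of_nonneg fun j _ => abs_nonneg _).1 h4 j
      (Finset.mem_univ j)
    rw [abs_eq_zero, Matrix.sub_apply, sub_eq_zero] at h5
    exact h5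
  · rintro rfl
    refine ⟨clusterMatrix_mem_sdpFeasible, fun Y hY => ?_⟩
    have h1 := key Y hY
    have h2 := mul_nonneg (sub_pos.2 hg).le (hsum Y)
    linarith

end Deterministic

/-! ### Noise averaged over communities. -/

section Blocks

variable {n k d : ℕ} {Φ : Fin n → Fin k} {Ω : Type*} [MeasurableSpace Ω] {ρ : ℝ}
  {μ : Measure Ω} [IsProbabilityMeasure μ] {w : Edge n d → Ω → ℝ}

/-- Averaging over a community divides the variance by its size: the coefficients are at most `1 /
s` and sum to one, so their squares sum to at most `1 / s`. -/
theorem IsBoundedFamily.measure_averaging_ge_le (h : IsBoundedFamily ρ μ w) (hd : 2 ≤ d)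
    (hn : 0 < n) (hρ : 0 ≤ ρ) {s η : ℝ} (hs : 0 < s) (hsize : ∀ i, s ≤ clusterSize Φ (Φ i))
    (hη : 0 < η) (hηθ : η ≤ ρ * (n : ℝ) ^ (d - 2))
    (hlog : 56 * (d : ℝ) ^ 2 * (ρ * (n : ℝ) ^ (d - 2)) * Real.log n ≤ η ^ 2 * s) (i j : Fin n)
    {σ : ℝ} (hσ : |σ| = 1) :
    μ.real {ω | η ≤ σ * (averaging Φ * centeredSimilarity μ w ω) i j} ≤ 1 / (n : ℝ) ^ 14 := by
  set θ := ρ * (n : ℝ) ^ (d - 2) with hθ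
  have hθ0 : 0 < θ := hη.trans_le hηθ
  have hd0 : (0 : ℝ) < d := by exact_mod_cast (by omega : 0 < d)
  have hd1 : (1 : ℝ) ≤ (d : ℝ) ^ 2 := one_le_pow₀ (by exact_mod_cast (by omega : 1 ≤ d))
  set f : Matrix (Fin n) (Fin n) ℝ :=
    Matrix.of fun l m => if m = j then σ * averaging Φ i l else 0 with hf
  have hP : ∀ l, averaging Φ i l ≤ 1 / s := by
    intro l
    simp only [averaging, Matrix.of_apply]
    split_ifs
    · exact one_div_le_one_div_of_le hs (hsize i)
    · positivity
  have hfrob : ∀ M : Matrix (Fin n) (Fin n) ℝ, frob M f = σ * (averaging Φ * M) i j := by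
    intro M
    simp only [frob, hf, Matrix.of_apply, mul_ite, mul_zero, Finset.sum_ite_eq', Finset.mem_univ,
      if_true, Matrix.mul_apply, Finset.mul_sum]
    exact Finset.sum_congr rfl fun l _ => by ring
  have hfle : ∀ l m, |f l m| ≤ 1 / s := by
    intro l m
    simp only [hf, Matrix.of_apply]
    split_ifs
    · rw [abs_mul, hσ, one_mul, abs_of_nonneg (averaging_nonneg i l)]
      exact hP l
    · rw [abs_zero]
      positivity
  have hfsq : ∑ l, ∑ m, f l m ^ 2 ≤ 1 / s := by
    have h1 : ∀ l, ∑ m, f l m ^ 2 = averaging Φ i l ^ 2 := by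
      intro l
      simp only [hf, Matrix.of_apply, ite_pow, ne_eq, OfNat.ofNat_ne_zero, not_false_eq_true,
        zero_pow, Finset.sum_ite_eq', Finset.mem_univ, if_true]
      rw [mul_pow, ← sq_abs σ, hσ, one_pow, one_mul]
    simp only [h1]
    calc ∑ l, averaging Φ i l ^ 2 ≤ ∑ l, 1 / s * averaging Φ i l := by
          refine Finset.sum_le_sum fun l _ => ?_
          rw [sq]
          exact mul_le_mul_of_nonneg_right (hP l) (averaging_nonneg i l)
      _ = 1 / s := by rw [← Finset.mul_sum, sum_averaging, mul_one]
  -- This minimizes `-L η + L² d² θ / s`; the assumption `η ≤ θ` keeps it in Bernstein's range.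
  set L := η * s / (2 * (d : ℝ) ^ 2 * θ) with hL
  have hL0 : 0 ≤ L := by positivity
  have hLF : L * ((d : ℝ) ^ 2 * (1 / s)) ≤ 1 := by
    have : L * ((d : ℝ) ^ 2 * (1 / s)) = η / (2 * θ) := by
      rw [hL]
      field_simp
    rw [this, div_le_one (by positivity)]
    linarith
  have key := h.measure_frob_centered_ge_le hd hρ (f := f) (by positivity) hfle hL0 hLF η
  simp only [hfrob] at key
  refine key.trans ?_
  rw [← exp_neg_mul_log hn]
  refine Real.exp_le_exp.2 ?_
  rw [← hθ]
  have h1 : L ^ 2 * (d : ℝ) ^ 2 * θ * ∑ l, ∑ m, f l m ^ 2 ≤ L ^ 2 * (d : ℝ) ^ 2 * θ * (1 / s) := by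
    gcongr
  have h2 : -L * η + L ^ 2 * (d : ℝ) ^ 2 * θ * (1 / s) = -(η ^ 2 * s / (4 * (d : ℝ) ^ 2 * θ)) := by
    rw [hL]
    field_simp
    ring
  have h3 : 14 * Real.log n ≤ η ^ 2 * s / (4 * (d : ℝ) ^ 2 * θ) := by
    rw [le_div_iff₀ (by positivity)]
    refine le_trans (le_of_eq ?_) hlog
    ring
  push_cast
  linarith

theorem IsBoundedFamily.measure_averaging_gt_le (h : IsBoundedFamily ρ μ w) (hd : 2 ≤ d)
    (hn : 2 ≤ n) (hρ : 0 ≤ ρ) {s η : ℝ} (hs : 0 < s) (hsize : ∀ i, s ≤ clusterSize Φ (Φ i))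
    (hη : 0 < η) (hηθ : η ≤ ρ * (n : ℝ) ^ (d - 2))
    (hlog : 56 * (d : ℝ) ^ 2 * (ρ * (n : ℝ) ^ (d - 2)) * Real.log n ≤ η ^ 2 * s) :
    μ.real {ω | ¬ ∀ i j, |(averaging Φ * centeredSimilarity μ w ω) i j| ≤ η}
      ≤ 1 / (n : ℝ) ^ 11 := by
  have hn' : (2 : ℝ) ≤ n := by exact_mod_cast hn
  have hsub : {ω | ¬ ∀ i j, |(averaging Φ * centeredSimilarity μ w ω) i j| ≤ η}
      ⊆ ⋃ x ∈ (Finset.univ : Finset (Fin n × Fin n)),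
        ({ω | η ≤ 1 * (averaging Φ * centeredSimilarity μ w ω) x.1 x.2} ∪
          {ω | η ≤ -1 * (averaging Φ * centeredSimilarity μ w ω) x.1 x.2}) := by
    intro ω hω
    simp only [Set.mem_ofPred_eq, not_forall, not_le] at hω
    obtain ⟨i, j, hij⟩ := hω
    simp only [Set.mem_iUnion, Set.mem_union, Set.mem_ofPred_eq]
    refine ⟨(i, j), Finset.mem_univ _, ?_⟩
    rcases lt_abs.1 hij with h1 | h1
    · left; linarith
    · right; linarith
  have hterm : ∀ x ∈ (Finset.univ : Finset (Fin n × Fin n)),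
      μ.real ({ω | η ≤ 1 * (averaging Φ * centeredSimilarity μ w ω) x.1 x.2} ∪
          {ω | η ≤ -1 * (averaging Φ * centeredSimilarity μ w ω) x.1 x.2})
      ≤ 2 / (n : ℝ) ^ 14 := by
    intro x _
    refine (measureReal_union_le _ _).trans ?_
    have h1 := h.measure_averaging_ge_le hd (by omega) hρ hs hsize hη hηθ hlog x.1 x.2
      (σ := 1) (by simp)
    have h2 := h.measure_averaging_ge_le hd (by omega) hρ hs hsize hη hηθ hlog x.1 x.2
      (σ := -1) (by simp)
    have h3 : 2 / (n : ℝ) ^ 14 = 1 / (n : ℝ) ^ 14 + 1 / (n : ℝ) ^ 14 := by ring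
    linarith
  refine (measureReal_mono hsub (measure_ne_top μ _)).trans
    ((measureReal_biUnion_finset_le _ _).trans ((Finset.sum_le_sum hterm).trans ?_))
  rw [Finset.sum_const, Finset.card_univ, Fintype.card_prod, Fintype.card_fin, nsmul_eq_mul]
  push_cast
  rw [mul_div_assoc', div_le_div_iff₀ (by positivity) (by positivity)]
  calc (n : ℝ) * n * 2 * (n : ℝ) ^ 11 = (n : ℝ) ^ 13 * 2 := by ring
    _ ≤ (n : ℝ) ^ 13 * n := by gcongr
    _ = _ := by ring

end Blocks

/-! ### Parameters of the model and consequences of the signal condition. -/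

section Model

variable {n k d : ℕ} {p q ε : ℝ} {Φ : Fin n → Fin k}

theorem similarityMatrix_mean (hd : 2 ≤ d) {Ω : Type*} [MeasurableSpace Ω] {μ : Measure Ω}
    [IsProbabilityMeasure μ] {W : Edge n d → Ω → ℝ} {B : Edge n d → Ω → Bool}
    (hW : IsSample p q Φ μ W) (hB : IsObservation ε μ W B) {i j : Fin n} (hij : i ≠ j) :
    similarityMatrix
      (fun e => ∫ ω, zeroImpute (observed (fun e => W e ω) (fun e => B e ω)) e ∂μ) i j
      = ε * expectedSimilarity d p q Φ (Φ i) (Φ j) := by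
  rw [← integral_similarityMatrix hd hW hij]
  simp only [hB.integral_zeroImpute hW, ← hW.mean]
  simp only [similarityMatrix, Matrix.of_apply, if_neg hij]
  have hint : ∀ e, Integrable (W e) μ := fun e =>
    Integrable.of_mem_Icc 0 1 (hW.measurable e).aemeasurable (hW.mem_Icc e)
  rw [integral_finsetSum, Finset.mul_sum]
  · refine Finset.sum_congr rfl fun e _ => ?_
    split_ifs <;> simp
  · intro e _
    by_cases h : i ∈ e.1 ∧ j ∈ e.1
    · simpa [h] using hint e
    · simp [h]

theorem sMin_le (Φ : Fin n → Fin k) (a : Fin k) : sMin Φ ≤ clusterSize Φ a :=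
  ciInf_le (OrderBot.bddBelow _) a

theorem sMin_pos (hn : 0 < n) (hΦ : Function.Surjective Φ) : 0 < sMin Φ := by
  have : Nonempty (Fin k) := ⟨Φ ⟨0, hn⟩⟩
  obtain ⟨a, ha⟩ := exists_eq_ciInf_of_finite (f := clusterSize Φ)
  obtain ⟨i, rfl⟩ := hΦ a
  rw [sMin, ← ha]
  exact clusterSize_pos i

theorem sMin_le_card (hn : 0 < n) : sMin Φ ≤ n := by
  refine (sMin_le Φ (Φ ⟨0, hn⟩)).trans ?_
  exact (Finset.card_le_univ _).trans_eq (Fintype.card_fin n)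

theorem le_pMinus (hn : 0 < n) (hqp : q ≤ p) :
    ((sMin Φ - 2).choose (d - 2) : ℝ) * (p - q) + qPlus n d q ≤ pMinus d p q Φ := by
  have : Nonempty (Fin k) := ⟨Φ ⟨0, hn⟩⟩
  refine le_ciInf fun a => ?_
  simp only [expectedSimilarity, if_true, qPlus]
  have h0 : 0 ≤ p - q := sub_nonneg.2 hqp
  gcongr
  exact sMin_le Φ a

theorem pMinus_le (a : Fin k) : pMinus d p q Φ ≤ expectedSimilarity d p q Φ a a :=
  ciInf_le (Set.finite_range _).bddBelow a

/-- `choose (s - 2) m` is at least this multiple of `s ^ m` if `s` is large. -/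
def chooseConst (m : ℕ) : ℝ := 1 / (2 ^ m * (m.factorial : ℝ))

theorem chooseConst_pos (m : ℕ) : 0 < chooseConst m := by
  unfold chooseConst
  positivity

/-- For `s ≥ 2 m + 2` the smallest factor `s - 1 - m` of the falling factorial is at least `s / 2`.
-/
theorem chooseConst_mul_pow_le {s m : ℕ} (hs : 2 * m + 2 ≤ s) :
    chooseConst m * (s : ℝ) ^ m ≤ ((s - 2).choose m : ℝ) := by
  have h1 := Nat.pow_le_choose (α := ℝ) m (s - 2)
  refine le_trans ?_ h1
  have h2 : (s : ℝ) / 2 ≤ ((s - 2 + 1 - m : ℕ) : ℝ) := by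
    rw [div_le_iff₀ (by norm_num)]
    exact_mod_cast (by omega : s ≤ (s - 2 + 1 - m) * 2)
  have h3 : chooseConst m * (s : ℝ) ^ m = ((s : ℝ) / 2) ^ m / (m.factorial : ℝ) := by
    rw [chooseConst, div_pow]
    field_simp
  rw [h3]
  gcongr

end Model

section Numerics

/-- The right side of the signal condition is bounded, so the condition itself forces the smallest
community to be large. -/
theorem mul_sqrt_div_le_one {p q ε : ℝ} (hq : 0 ≤ q) (hqp : q < p) (hp : p ≤ 1) (hε : ε ≤ 1) :
    (p - q) * Real.sqrt (ε / p) ≤ 1 := by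
  have hp0 : 0 < p := by linarith
  calc (p - q) * Real.sqrt (ε / p) ≤ p * Real.sqrt (1 / p) := by
        gcongr
        linarith
    _ = Real.sqrt p := by
        rw [Real.sqrt_div zero_le_one, Real.sqrt_one, mul_one_div, Real.div_sqrt]
    _ ≤ 1 := Real.sqrt_le_one.2 hp

theorem le_of_mul_pow_le_one {C c x : ℝ} {m : ℕ} (hx : 0 < x)
    (hc : C ^ (m + 1) ≤ c) (h : c * x ^ (m + 1) ≤ 1) : C * x ≤ 1 := by
  by_contra hlt
  rw [not_le] at hlt
  have h1 : 1 < (C * x) ^ (m + 1) := one_lt_pow₀ hlt (by omega)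
  rw [mul_pow] at h1
  have h2 : C ^ (m + 1) * x ^ (m + 1) ≤ c * x ^ (m + 1) := by gcongr
  linarith

/-- The signal-to-noise condition, cleared of denominators. -/
theorem signal_ge {p q ε N s c X G κ : ℝ} {m : ℕ} (hp : 0 < p) (hε : 0 ≤ ε) (hN : 0 ≤ N)
    (hs : 0 < s) (hqp : q ≤ p) (hκ : 0 ≤ κ)
    (hG : κ * s ^ m ≤ G)
    (h : c * (Real.sqrt N / s) ^ m * X ≤ (p - q) * Real.sqrt (ε / p)) :
    κ * c * Real.sqrt (p * ε * N ^ m) * X ≤ ε * (G * (p - q)) := by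
  have h1 : Real.sqrt (ε / p) * Real.sqrt (p * ε) = ε := by
    rw [← Real.sqrt_mul (by positivity)]
    have : ε / p * (p * ε) = ε ^ 2 := by field_simp
    rw [this, Real.sqrt_sq hε]
  have h2 : Real.sqrt (p * ε * N ^ m) = Real.sqrt (p * ε) * Real.sqrt N ^ m := by
    have : N ^ m = (Real.sqrt N ^ m) ^ 2 := by
      rw [← pow_mul, mul_comm m 2, pow_mul, Real.sq_sqrt hN]
    rw [Real.sqrt_mul (by positivity), this, Real.sqrt_sq (by positivity)]
  calc κ * c * Real.sqrt (p * ε * N ^ m) * X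
      = κ * s ^ m * Real.sqrt (p * ε) * (c * (Real.sqrt N / s) ^ m * X) := by
        rw [h2, div_pow]
        field_simp
    _ ≤ κ * s ^ m * Real.sqrt (p * ε) * ((p - q) * Real.sqrt (ε / p)) := by gcongr
    _ = κ * s ^ m * ((p - q) * (Real.sqrt (ε / p) * Real.sqrt (p * ε))) := by ring
    _ = κ * s ^ m * ((p - q) * ε) := by rw [h1]
    _ ≤ G * ((p - q) * ε) := by
        have := sub_nonneg.2 hqp
        gcongr
    _ = _ := by ring

end Numerics

/-! ### Assembly. -/

/-- The semidefinite program succeeds with high probability if the signal `γ` exceeds both the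
spectral norm of the noise and its averages over communities. -/
theorem measure_sdpSolutions_ge {n k d : ℕ} {p q ε l : ℝ} {Φ : Fin n → Fin k} (hd : 2 ≤ d)
    (hn : 20 ≤ n) (hq : 0 ≤ q) (hqp : q < p) (hε : 0 ≤ ε)
    (hl1 : 1 / 4 * (pMinus d p q Φ * ε) + 3 / 4 * (qPlus n d q * ε) ≤ l)
    (hl2 : l ≤ 3 / 4 * (pMinus d p q Φ * ε) + 1 / 4 * (qPlus n d q * ε))
    {γ r : ℝ} (hγ : 0 < γ) (hγle : γ ≤ (pMinus d p q Φ - qPlus n d q) * ε)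
    (hγθ : γ ≤ p * ε * (n : ℝ) ^ (d - 2))
    (hr : 1 ≤ r) (hr2 : p * ε * (n : ℝ) ^ (d - 2) = r ^ 2 / n) (hlog : Real.log n ≤ r ^ 2)
    (hs : 0 < sMin Φ) (hspec : 8 * (spectralConst d * r) < γ * sMin Φ)
    (hblock : 56 * (d : ℝ) ^ 2 * (p * ε * (n : ℝ) ^ (d - 2)) * Real.log n
      ≤ (γ / 24) ^ 2 * sMin Φ)
    {Ω : Type*} [MeasurableSpace Ω] {μ : Measure Ω} [IsProbabilityMeasure μ]
    {W : Edge n d → Ω → ℝ} {B : Edge n d → Ω → Bool}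
    (hW : IsSample p q Φ μ W) (hB : IsObservation ε μ W B) :
    1 - 6 / (n : ℝ) ^ 11 ≤ μ.real {ω | sdpSolutions
      (similarityMatrix (zeroImpute (observed (fun e => W e ω) (fun e => B e ω)))) l
        = {clusterMatrix Φ}} := by
  have hp : 0 < p := by linarith
  have hs' : (0 : ℝ) < sMin Φ := by exact_mod_cast hs
  have hρ : 0 ≤ p * ε := by positivity
  set w : Edge n d → Ω → ℝ :=
    fun e ω => zeroImpute (observed (fun e => W e ω) (fun e => B e ω)) e with hw
  have hfam : IsBoundedFamily (p * ε) μ w := hB.isBoundedFamily hqp.le hε hW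
  have hsize : ∀ i, (sMin Φ : ℝ) ≤ clusterSize Φ (Φ i) := fun i => by
    exact_mod_cast sMin_le Φ (Φ i)
  set E1 := {ω | ¬ ∀ x : Fin n → ℝ, ∑ i, ∑ j, centeredSimilarity μ w ω i j * (x i * x j)
        ≤ spectralConst d * r * ∑ i, x i ^ 2}
  set E2 := {ω | ¬ ∀ i j, |(averaging Φ * centeredSimilarity μ w ω) i j| ≤ γ / 24}
  set S := {ω | sdpSolutions
      (similarityMatrix (zeroImpute (observed (fun e => W e ω) (fun e => B e ω)))) l
        = {clusterMatrix Φ}}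
  have h1 : μ.real E1 ≤ 3 / (n : ℝ) ^ 11 :=
    hfam.measure_quadratic_form_gt_le hd hn hρ hr hr2 hlog
  have h2 : μ.real E2 ≤ 1 / (n : ℝ) ^ 11 :=
    hfam.measure_averaging_gt_le hd (by omega) hρ hs' hsize (by positivity)
      (by linarith) hblock
  -- Covering the whole space by the success set and the bad events needs only subadditivity, so
  -- measurability of the success set is not required.
  have hcover : (Set.univ : Set Ω) ⊆ S ∪ (E1 ∪ E2) := by
    intro ω _
    by_contra hcon
    simp only [E1, E2, Set.mem_union, Set.mem_ofPred_eq, not_or, not_not] at hcon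
    obtain ⟨hS, g1, g2⟩ := hcon
    apply hS
    have hK : 0 ≤ spectralConst d * r := by unfold spectralConst; positivity
    refine sdpSolutions_eq_singleton (P := similarityMatrix fun e => ∫ ω, w e ω ∂μ)
      -- Budget: `3 η = γ / 8` and `K / s < γ / 8`, against the signal `γ / 4`.
      (M := centeredSimilarity μ w ω) (g := γ / 4) (η := γ / 24) (K := spectralConst d * r)
      (s := sMin Φ) ?_ ?_ hK hs' hsize ?_ ?_ g2 g1 ?_
    · ext i j
      rw [Matrix.add_apply, centeredSimilarity, similarityMatrix_sub]
      ring
    · ext i j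
      exact similarityMatrix_symm _ _ _
    · intro i j hij hΦ
      rw [similarityMatrix_mean hd hW hB hij, ← hΦ]
      have := mul_le_mul_of_nonneg_left (pMinus_le (d := d) (p := p) (q := q) (Φ := Φ) (Φ i)) hε
      linarith
    · intro i j hΦ
      rw [similarityMatrix_mean hd hW hB (fun h => hΦ (by rw [h])), expectedSimilarity,
        if_neg hΦ]
      change _ ≤ l - ε * qPlus n d q
      linarith
    · have : spectralConst d * r / sMin Φ < γ / 8 := by
        rw [div_lt_iff₀ hs']
        linarith
      linarith
  have h3 := (measureReal_mono hcover (measure_ne_top μ _)).trans (measureReal_union_le S (E1 ∪ E2))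
  have h4 := measureReal_union_le (μ := μ) E1 E2
  rw [probReal_univ] at h3
  have h5 : 6 / (n : ℝ) ^ 11 = 3 / (n : ℝ) ^ 11 + 1 / (n : ℝ) ^ 11 + 2 / (n : ℝ) ^ 11 := by ring
  have h6 : 0 ≤ 2 / (n : ℝ) ^ 11 := by positivity
  linarith

/-- The signal dominates the noise level `r = √(N θ)`. -/
theorem exists_noise_level {N s θ γ b c : ℝ} (hN : 1 ≤ N) (hs : 0 < s) (hsN : s ≤ N)
    (hθ : 0 < θ) (hγθ : γ ≤ θ) (hb : 1 ≤ b) (hbc : b ≤ c)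
    (h1 : c * Real.sqrt θ * (Real.sqrt N / s) ≤ γ)
    (h2 : c * Real.sqrt θ * Real.sqrt (Real.log N / s) ≤ γ) :
    ∃ r : ℝ, 0 < r ∧ r ^ 2 = N * θ ∧ b * r ≤ γ * s ∧ b * (θ * Real.log N) ≤ γ ^ 2 * s ∧
      Real.log N ≤ r ^ 2 := by
  have hlog0 : 0 ≤ Real.log N := Real.log_nonneg hN
  have hr2 : Real.sqrt (N * θ) ^ 2 = N * θ := Real.sq_sqrt (by positivity)
  have hc0 : 0 ≤ c := by linarith
  have hγ0 : 0 ≤ γ := le_trans (by positivity) h1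
  have hB : b * (θ * Real.log N) ≤ γ ^ 2 * s := by
    have h3 : b * (Real.sqrt θ * Real.sqrt (Real.log N / s)) ≤ γ := by
      refine le_trans ?_ h2
      rw [mul_assoc]
      gcongr
    have h4 : (b * (Real.sqrt θ * Real.sqrt (Real.log N / s))) ^ 2 ≤ γ ^ 2 := by gcongr
    rw [mul_pow, mul_pow, Real.sq_sqrt hθ.le, Real.sq_sqrt (by positivity)] at h4
    calc b * (θ * Real.log N) ≤ b ^ 2 * (θ * Real.log N) := by
          have : b ≤ b ^ 2 := by nlinarith
          gcongr
      _ = b ^ 2 * (θ * (Real.log N / s)) * s := by field_simp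
      _ ≤ _ := by gcongr
  refine ⟨Real.sqrt (N * θ), Real.sqrt_pos.2 (by positivity), hr2, ?_, hB, ?_⟩
  · have e : c * Real.sqrt θ * (Real.sqrt N / s) = c * Real.sqrt (N * θ) / s := by
      rw [Real.sqrt_mul (by positivity)]
      ring
    rw [e, div_le_iff₀ hs] at h1
    refine le_trans ?_ h1
    gcongr
  · rw [hr2]
    -- Since `γ ≤ θ`, the averaging condition yields `log N ≤ θ s`, hence `log N ≤ θ N = r²`.
    have h3 : θ * Real.log N ≤ θ * (θ * s) := by
      calc θ * Real.log N ≤ b * (θ * Real.log N) := le_mul_of_one_le_left (by positivity) hb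
        _ ≤ γ ^ 2 * s := hB
        _ ≤ θ ^ 2 * s := by gcongr
        _ = _ := by ring
    refine (le_of_mul_le_mul_left h3 hθ).trans ?_
    rw [mul_comm]
    gcongr

end WHSBM

end

theorem corollary5p1 (d : ℕ) (hd : 2 ≤ d) :
    ∃ c₂ : ℝ, 0 < c₂ ∧
      ∀ (n k : ℕ) (p q ε l : ℝ) (Φ : Fin n → Fin k),
        0 < n → Function.Surjective Φ →
        0 ≤ q → q < p → p ≤ 1 → 0 ≤ ε → ε ≤ 1 →
        (1 / 4 * (WHSBM.pMinus d p q Φ * ε) + 3 / 4 * (WHSBM.qPlus n d q * ε) ≤ l ∧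
          l ≤ 3 / 4 * (WHSBM.pMinus d p q Φ * ε) + 1 / 4 * (WHSBM.qPlus n d q * ε)) →
        c₂ * (Real.sqrt n / (WHSBM.sMin Φ : ℝ)) ^ (d - 2) *
            max (Real.sqrt n / (WHSBM.sMin Φ : ℝ))
              (Real.sqrt (Real.log n / (WHSBM.sMin Φ : ℝ)))
          ≤ (p - q) * Real.sqrt (ε / p) →
        ∀ (Ω : Type*) [MeasurableSpace Ω] (μ : Measure Ω) [IsProbabilityMeasure μ]
          (W : WHSBM.Edge n d → Ω → ℝ) (B : WHSBM.Edge n d → Ω → Bool),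
          WHSBM.IsSample p q Φ μ W → WHSBM.IsObservation ε μ W B →
          1 - 6 / (n : ℝ) ^ 11 ≤
            μ.real {ω | WHSBM.sdpSolutions
                (WHSBM.similarityMatrix
                  (WHSBM.zeroImpute
                    (WHSBM.observed (fun e => W e ω) (fun e => B e ω)))) l
              = {WHSBM.clusterMatrix Φ}} := by
  obtain ⟨m, rfl⟩ : ∃ m, d = m + 2 := ⟨d - 2, by omega⟩
  set κ := WHSBM.chooseConst m with hκ
  have hκ0 : 0 < κ := WHSBM.chooseConst_pos m
  set D : ℝ := ((m + 2 : ℕ) : ℝ) with hD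
  have hD2 : (2 : ℝ) ≤ D := by
    rw [hD]
    exact_mod_cast hd
  set T := WHSBM.spectralConst (m + 2) with hT
  have hT0 : 0 < T := by rw [hT, WHSBM.spectralConst]; positivity
  -- `8 T` serves the spectral condition and `40000 D²` covers `56 · 24² D² = 32256 D²` from the
  -- averaging condition; the final `1` ensures `1 ≤ b`. In `c` below, the first summand forces `s ≥
  -- 20 + 2 D` and the second makes `κ c ≥ b`.
  set b : ℝ := 8 * T + 40000 * D ^ 2 + 1 with hb
  set c : ℝ := (20 + 2 * D) ^ (m + 1) + b / κ with hc
  have hb0 : 0 < b := by positivity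
  refine ⟨c, by positivity, ?_⟩
  intro n k p q ε l Φ hn hΦ hq hqp hp hε0 hε1 hl hsig Ω _ μ _ W B hW hB
  rcases Nat.lt_or_ge n 2 with hn2 | hn2
  -- Here the claimed probability `1 - 6` is negative.
  · obtain rfl : n = 1 := by omega
    norm_num
    exact le_trans (by norm_num) measureReal_nonneg
  simp only [Nat.add_sub_cancel] at hsig
  have hp0 : 0 < p := by linarith
  have hpq0 : 0 ≤ p - q := by linarith
  have hnR : (2 : ℝ) ≤ n := by exact_mod_cast hn2
  have hs := WHSBM.sMin_pos hn hΦ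
  have hsn : WHSBM.sMin Φ ≤ n := WHSBM.sMin_le_card hn
  set s := WHSBM.sMin Φ with hsdef
  have hs' : (0 : ℝ) < s := by exact_mod_cast hs
  have hsnR : (s : ℝ) ≤ n := by exact_mod_cast hsn
  have hx0 : 0 < Real.sqrt n / s := by positivity
  have hsig1 : c * (Real.sqrt n / s) ^ m * (Real.sqrt n / s) ≤ (p - q) * Real.sqrt (ε / p) :=
    (mul_le_mul_of_nonneg_left (le_max_left _ _) (by positivity)).trans hsig
  have hsig2 : c * (Real.sqrt n / s) ^ m * Real.sqrt (Real.log n / s)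
      ≤ (p - q) * Real.sqrt (ε / p) :=
    (mul_le_mul_of_nonneg_left (le_max_right _ _) (by positivity)).trans hsig
  have hbig : (20 + 2 * D) * (Real.sqrt n / s) ≤ 1 := by
    refine WHSBM.le_of_mul_pow_le_one (m := m) (c := c) hx0 ?_ ?_
    · rw [hc]
      have : 0 ≤ b / κ := by positivity
      linarith
    · rw [pow_succ, ← mul_assoc]
      exact hsig1.trans (WHSBM.mul_sqrt_div_le_one hq hqp hp hε1)
  have hsbig : 20 + 2 * D ≤ s := by
    rw [mul_div_assoc', div_le_one hs'] at hbig
    refine le_trans ?_ hbig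
    have : 1 ≤ Real.sqrt n := Real.one_le_sqrt.2 (by linarith)
    nlinarith
  have hsN : 20 + 2 * (m + 2) ≤ s := by
    rw [hD] at hsbig
    exact_mod_cast hsbig
  have hn20 : 20 ≤ n := by omega
  set G : ℝ := ((s - 2).choose m : ℝ) with hG
  have hGlow : κ * (s : ℝ) ^ m ≤ G := WHSBM.chooseConst_mul_pow_le (by omega)
  have hGup : G ≤ (n : ℝ) ^ m := by
    rw [hG]
    exact_mod_cast (Nat.choose_le_pow _ _).trans (Nat.pow_le_pow_left (by omega) _)
  set θ : ℝ := p * ε * (n : ℝ) ^ m with hθ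
  have hθ0 : 0 ≤ θ := by positivity
  set γ : ℝ := ε * (G * (p - q)) with hγ
  have hκc : b ≤ κ * c := by
    rw [hc, mul_add, mul_div_cancel₀ _ hκ0.ne']
    have : 0 ≤ κ * (20 + 2 * D) ^ (m + 1) := by positivity
    linarith
  have hγ1 := WHSBM.signal_ge hp0 hε0 (Nat.cast_nonneg n) hs' hqp.le hκ0.le hGlow hsig1
  have hγ2 := WHSBM.signal_ge hp0 hε0 (Nat.cast_nonneg n) hs' hqp.le hκ0.le hGlow hsig2
  rw [← hγ, ← hθ] at hγ1 hγ2
  have hγθ : γ ≤ θ := by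
    calc γ ≤ ε * ((n : ℝ) ^ m * p) := by
          rw [hγ]
          gcongr
          linarith
      _ = θ := by rw [hθ]; ring
  have hε : 0 < ε := by
    rcases hε0.lt_or_eq with h | h
    · exact h
    · rw [← h] at hsig1
      simp only [zero_div, Real.sqrt_zero, mul_zero] at hsig1
      have : 0 < c * (Real.sqrt n / s) ^ m * (Real.sqrt n / s) := by positivity
      linarith
  have hθpos : 0 < θ := by positivity
  have hb1 : 1 ≤ b := by
    have : 0 ≤ 8 * T + 40000 * D ^ 2 := by positivity
    linarith
  obtain ⟨r, hrpos, hr2, hA, hB2, hlogr⟩ := WHSBM.exists_noise_level (by linarith) hs' hsnR hθpos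
    hγθ hb1 hκc hγ1 hγ2
  have hγpos : 0 < γ := by
    by_contra h0
    have h1 : 0 < b * r := mul_pos hb0 hrpos
    have h2 := mul_nonpos_of_nonpos_of_nonneg (not_lt.1 h0) hs'.le
    linarith
  have hr1 : 1 ≤ r := by
    have h1 : 1 ≤ Real.log n := by
      rw [Real.le_log_iff_exp_le (by linarith)]
      have : (20 : ℝ) ≤ n := by exact_mod_cast hn20
      linarith [Real.exp_one_lt_d9]
    exact (one_le_sq_iff₀ hrpos.le).1 (h1.trans hlogr)
  have hlog0 : 0 ≤ Real.log n := Real.log_nonneg (by linarith)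
  have hpm := WHSBM.le_pMinus (d := m + 2) (Φ := Φ) hn hqp.le
  simp only [Nat.add_sub_cancel] at hpm
  refine WHSBM.measure_sdpSolutions_ge hd hn20 hq hqp hε0 hl.1 hl.2 (γ := γ) (r := r) hγpos ?_
    hγθ hr1 ?_ hlogr hs ?_ ?_ hW hB
  · rw [hγ, mul_comm]
    gcongr
    linarith
  · rw [hr2]
    simp only [Nat.add_sub_cancel]
    rw [← hθ]
    field_simp
  · refine lt_of_lt_of_le ?_ hA
    have h1 : 8 * T < b := by
      have : 0 ≤ 40000 * D ^ 2 := by positivity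
      linarith
    calc 8 * (T * r) = 8 * T * r := by ring
      _ < b * r := by gcongr
  · simp only [Nat.add_sub_cancel]
    rw [← hθ, ← hD]
    have h1 : 32256 * D ^ 2 ≤ b := by
      rw [hb]
      linarith only [sq_nonneg D, hT0]
    have h2 : 32256 * D ^ 2 * (θ * Real.log n) ≤ γ ^ 2 * s :=
      (mul_le_mul_of_nonneg_right h1 (by positivity)).trans hB2
    have h3 : (γ / 24) ^ 2 * s = γ ^ 2 * s / 576 := by ring
    rw [h3, le_div_iff₀ (by norm_num)]
    linarith only [h2]
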